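/- Let a particle move in $[0,1]$ between two thermal walls with inverse temperatures $\beta_L$ (at $0$) and $\beta_R$ (at $1$). It starts at $q_0\in[0,1]$ with velocity $p_0\neq0$. At each wall it is reflected with a random speed, independent of the past, of law $\phi_\beta(dp)=\beta p\,e^{-\beta p^2/2}\mathbf 1_{\{p>0\}}\,dp$, with $\beta=\beta_L$ at the left wall and $\beta=\beta_R$ at the right wall. Let $\sigma_k=(-1)^k\,\mathrm{sign}(p_0)$, let $S_0=\big(\tfrac{\sigma_0+1}{2}-q_0\big)/p_0$ be the time of the first collision, let $S_k=S_0+\tau_1+\dots+\tau_k$, where $\tau_k$ is the duration of the $k$-th flight between the walls, and let $v_k=\sigma_k/\tau_k$. The energy exchanged during $[0,t]$ is $J[0,t]=\frac12\sum_{k\ge1,\,S_k\le t}\sigma_kv_k^2$. For $\beta_L,\beta_R>0$ and $\lambda\in\mathbb R$ the limit $$f(\lambda,\beta_L,\beta_R)=\lim_{t\to\infty}\frac1t\log\mathbb E\big(e^{\lambda J[0,t]}\big)\in(-\infty,+\infty]$$ exists. Put $$\mathcal F(\lambda,\tau,T)=f\Big(\lambda,\frac1{T+\tau/2},\frac1{T-\tau/2}\Big),\qquad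 \mathcal I(j,\tau,T)=\sup_{\lambda\in\mathbb R}\{\lambda j-\mathcal F(\lambda,\tau,T)\}.$$ Let $T>0$ and $\kappa=\kappa(T)=(T/2\pi)^{1/2}$. 1. If $\tau\ne0$, then for all $\lambda,j\in\mathbb R$ $$\lim_{\varepsilon\downarrow0}\varepsilon^{-2}\mathcal F(\varepsilon\lambda,\varepsilon\tau,T)=\mathcal H(\lambda,\tau,T):=\begin{cases}\lambda\kappa\tau+\kappa\lambda^2T^2&\text{if }\lambda\tau>0,\\ 0&\text{if }\lambda\tau\in[-\tau^2/T^2,0],\\ -\big(\lambda+\frac{\tau}{T^2}\big)\kappa\tau+\kappa\big(\lambda+\frac{\tau}{T^2}\big)^2T^2&\text{if }\lambda\tau<-\tau^2/T^2,\end{cases}$$ $$\lim_{\varepsilon\downarrow0}\varepsilon^{-2}\mathcal I(\varepsilon j,\varepsilon\tau,T)=\mathcal G(j,\tau,T):=\begin{cases}\frac{(j-\kappa\tau)^2}{4\kappa T^2}&\text{if }j\tau>\kappa\tau^2,\\ 0&\text{if }j\tau\in[0,\kappa\tau^2],\\ \frac{-j\tau}{T^2}&\text{if }j\tau\in[-\kappa\tau^2,0],\\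 \frac{(j-\kappa\tau)^2}{4\kappa T^2}&\text{if }j\tau<-\kappa\tau^2.\end{cases}$$ 2. If $\tau=0$, then $\lim_{\varepsilon\downarrow0}\varepsilon^{-2}\mathcal F(\varepsilon\lambda,0,T)=\kappa\lambda^2T^2$ and $\lim_{\varepsilon\downarrow0}\varepsilon^{-2}\mathcal I(\varepsilon j,0,T)=\frac{j^2}{4\kappa T^2}$ for all $\lambda,j\in\mathbb R$. With $\mathcal H(\lambda,0,T):=\kappa\lambda^2T^2$ and $\mathcal G(j,0,T):=\frac{j^2}{4\kappa T^2}$, these convergences are uniform in $(\lambda,\tau,T)$, respectively in $(j,\tau,T)$, on every compact subset of $\mathbb R\times\mathbb R\times(0,\infty)$. -/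

import Mathlib

open MeasureTheory Filter Topology

noncomputable section

namespace ConfinedTracer

/-! ### A particle in `[0, 1]` between two thermal walls -/

/-- The law `φ_β(dp) = β p exp(-β p² / 2) 1_{p > 0} dp` of the speed with which a particle leaves a
wall of inverse temperature `β`. -/
def wallLaw (β : ℝ) : Measure ℝ :=
  (volume.restrict (Set.Ioi (0 : ℝ))).withDensity
    fun p => ENNReal.ofReal (β * p * Real.exp (-(β * p ^ 2 / 2)))

/-- `φ_β` is a probability law. -/
theorem isProbabilityMeasure_wallLaw {β : ℝ} (hβ : 0 < β) :
    IsProbabilityMeasure (wallLaw β) := by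
  constructor
  have hd : ∀ x ∈ Set.Ici (0 : ℝ), HasDerivAt (fun p : ℝ => -Real.exp (-(β * p ^ 2 / 2)))
      (β * x * Real.exp (-(β * x ^ 2 / 2))) x := by
    intro x _
    have h : HasDerivAt (fun p : ℝ => -Real.exp (-(β * p ^ 2 / 2)))
        (-(Real.exp (-(β * x ^ 2 / 2)) * -(β * ((2 : ℕ) * x ^ (2 - 1)) / 2))) x :=
      ((((hasDerivAt_pow 2 x).const_mul β).div_const 2).neg.exp).neg
    refine h.congr_deriv ?_
    push_cast
    ring
  have hlim : Tendsto (fun p : ℝ => -Real.exp (-(β * p ^ 2 / 2))) atTop (𝓝 0) := by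
    rw [← neg_zero]
    refine (Real.tendsto_exp_neg_atTop_nhds_zero.comp ?_).neg
    exact ((tendsto_pow_atTop two_ne_zero).const_mul_atTop hβ).atTop_div_const two_pos
  have hpos : ∀ x ∈ Set.Ioi (0 : ℝ), 0 ≤ β * x * Real.exp (-(β * x ^ 2 / 2)) := by
    intro x hx
    have : (0 : ℝ) < x := hx
    positivity
  have hi := integrableOn_Ioi_deriv_of_nonneg' hd hpos hlim
  have hv := integral_Ioi_of_hasDerivAt_of_nonneg' hd hpos hlim
  rw [wallLaw, withDensity_apply _ MeasurableSet.univ, Measure.restrict_univ,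
    ← ofReal_integral_eq_lintegral_ofReal hi
      ((ae_restrict_iff' measurableSet_Ioi).2 (Eventually.of_forall hpos)), hv]
  simp

/-- The signs `σ_k = (-1)^k σ_0`, where `σ_0 = sign p₀`. -/
def flightSign (p₀ : ℝ) (k : ℕ) : ℝ := (-1) ^ k * Real.sign p₀

/-- `β_{-1} = β_L` (left wall) and `β_{1} = β_R` (right wall). -/
def wallBeta (βL βR σ : ℝ) : ℝ := if 0 < σ then βR else βL

/-- The joint law of the speeds of the successive flights between the walls. The coordinate `k`
is the speed `1 / τ_{k+1}` of flight number `k + 1`; the coordinates are independent and `1 / τ_{k+1}`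
has law `φ_β` with `β = β_{σ_k}`. -/
def speedLaw (βL βR p₀ : ℝ) : Measure (ℕ → ℝ) :=
  Measure.infinitePi fun k => wallLaw (wallBeta βL βR (flightSign p₀ k))

/-- The duration `τ_{k+1}` of flight number `k + 1`. -/
def flightTime (ω : ℕ → ℝ) (k : ℕ) : ℝ := 1 / ω k

/-- The time `S_k = S_0 + τ_1 + ⋯ + τ_k` of the collision number `k + 1` with the walls, where
`S_0 = (σ̂_0 - q₀) / p₀` and `σ̂_0 = (σ_0 + 1) / 2` is the wall towards which the particle starts. -/
def collisionTime (q₀ p₀ : ℝ) (ω : ℕ → ℝ) (k : ℕ) : ℝ :=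
  ((Real.sign p₀ + 1) / 2 - q₀) / p₀ + ∑ i ∈ Finset.range k, flightTime ω i

/-- The velocity `v_{k+1} = σ_{k+1} / τ_{k+1}` during flight number `k + 1`. -/
def flightVelocity (p₀ : ℝ) (ω : ℕ → ℝ) (k : ℕ) : ℝ :=
  flightSign p₀ (k + 1) / flightTime ω k

/-- The energy `J[0,t] = (1/2) ∑_{k ≥ 1, S_k ≤ t} v_k² σ_k` exchanged between the walls during
`[0, t]` (almost surely a finite sum). -/
def energyCurrent (q₀ p₀ : ℝ) (ω : ℕ → ℝ) (t : ℝ) : ℝ :=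
  (1 / 2) * ∑' k : ℕ, if collisionTime q₀ p₀ ω (k + 1) ≤ t then
    flightVelocity p₀ ω k ^ 2 * flightSign p₀ (k + 1) else 0

/-- `(1/t) log E (exp (l J[0,t]))`, with value `+∞` where the expectation is infinite. -/
def scaledCumulant (q₀ p₀ βL βR l t : ℝ) : EReal :=
  ((1 / t : ℝ) : EReal) *
    ENNReal.log (∫⁻ ω, ENNReal.ofReal (Real.exp (l * energyCurrent q₀ p₀ ω t))
      ∂(speedLaw βL βR p₀))

/-- The cumulant generating function
`f(l, β_L, β_R) = lim_{t → ∞} (1/t) log E (exp (l J[0,t]))` (written as an upper limit; that it is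
a limit is part of the theorem). -/
def cumulantGF (q₀ p₀ l βL βR : ℝ) : EReal :=
  limsup (fun t : ℝ => scaledCumulant q₀ p₀ βL βR l t) atTop

/-! ### The scaling limit -/

/-- `𝓕(l, τ, T) = f(l, 1 / (T + τ/2), 1 / (T - τ/2))`. -/
def calF (q₀ p₀ l τ T : ℝ) : EReal :=
  cumulantGF q₀ p₀ l (1 / (T + τ / 2)) (1 / (T - τ / 2))

/-- The Legendre transform `𝓘(j, τ, T) = sup_l (l j - 𝓕(l, τ, T))`. -/
def calI (q₀ p₀ j τ T : ℝ) : EReal :=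
  ⨆ l : ℝ, (((l * j : ℝ) : EReal) - calF q₀ p₀ l τ T)

/-- `κ = (T / 2π)^{1/2}`. -/
def kappa (T : ℝ) : ℝ := Real.sqrt (T / (2 * Real.pi))

/-- The limit `𝓗(l, τ, T)` of the cumulant generating function. -/
def calH (l τ T : ℝ) : ℝ :=
  if τ = 0 then kappa T * l ^ 2 * T ^ 2
  else if 0 < l * τ then l * kappa T * τ + kappa T * l ^ 2 * T ^ 2
  else if -(τ ^ 2 / T ^ 2) ≤ l * τ then 0
  else -(l + τ / T ^ 2) * kappa T * τ + kappa T * (l + τ / T ^ 2) ^ 2 * T ^ 2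

/-- The limit `𝓖(j, τ, T)` of the Legendre transform. -/
def calG (j τ T : ℝ) : ℝ :=
  if τ = 0 then j ^ 2 / (4 * kappa T * T ^ 2)
  else if kappa T * τ ^ 2 < j * τ then (j - kappa T * τ) ^ 2 / (4 * kappa T * T ^ 2)
  else if 0 ≤ j * τ then 0
  else if -(kappa T * τ ^ 2) ≤ j * τ then -(j * τ) / T ^ 2
  else (j - kappa T * τ) ^ 2 / (4 * kappa T * T ^ 2)

end ConfinedTracer

end

/-!
Decomposing at the first flight gives a renewal equation for `E (exp (l J[0,t]))`. A flight from a
wall of inverse temperature `β` contributes the factor `E (exp (θ x² / 2 - s / x))`, where `x` is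
its speed, `θ = l` at the left wall and `θ = -l` at the right one, so the expectation grows like
`exp (s t)`, where `s` is the threshold at which the product of the two factors crosses one. Tilting
by `θ` turns `β` into `β - θ`, at the cost of the factor `β / (β - θ)`, and leaves the Laplace
transform of the flight time `1 / x`. Under the scaling the threshold is of order `ε²`, and since
the flight time has a finite moment of order `3 / 2`, its Laplace transform at `s` is
`1 - s E (1 / x)` up to `O (s ^ (3 / 2))`, uniformly in the parameters. Solving for the threshold
gives the limit `𝓗 = κ max (0, l τ + l² T²)`. A coercive lower bound confines the maximizers of the
Legendre transforms to a compact set, so these converge to the Legendre transform of `𝓗`.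
-/

noncomputable section

namespace ConfinedTracer

section Product

variable {X : Type*}

/-- The sequence with first term `p.1`, followed by the sequence `p.2`. -/
def seqCons (p : X × (ℕ → X)) : ℕ → X := fun k => Nat.casesOn k p.1 p.2

@[simp] theorem seqCons_zero (p : X × (ℕ → X)) : seqCons p 0 = p.1 := rfl

@[simp] theorem seqCons_succ (p : X × (ℕ → X)) (k : ℕ) : seqCons p (k + 1) = p.2 k := rfl

theorem seqCons_preimage_pi (s : Finset ℕ) (t : ℕ → Set X) :
    seqCons ⁻¹' (s : Set ℕ).pi t = {x | 0 ∈ s → x ∈ t 0} ×ˢ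
      (s.preimage Nat.succ Nat.succ_injective.injOn : Set ℕ).pi fun k => t (k + 1) := by
  ext ⟨x, ω⟩
  simp only [Set.mem_preimage, Set.mem_pi, Set.mem_prod, Finset.mem_coe, Finset.mem_preimage,
    Set.mem_ofPred_eq]
  exact ⟨fun h => ⟨h 0, fun k => h (k + 1)⟩, fun h k => Nat.casesOn k h.1 h.2⟩

theorem prod_eq_mul_prod_preimage_succ {M : Type*} [CommMonoid M] (s : Finset ℕ) (f : ℕ → M) :
    ∏ k ∈ s, f k = (if 0 ∈ s then f 0 else 1) *
      ∏ k ∈ s.preimage Nat.succ Nat.succ_injective.injOn, f (k + 1) := by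
  classical
  rw [Finset.prod_preimage' Nat.succ s Nat.succ_injective.injOn f, Nat.range_succ,
    ← Finset.prod_filter_mul_prod_filter_not s (· = 0) f, Finset.filter_eq']
  congr 1
  · split_ifs <;> simp
  · exact Finset.prod_congr (by ext k; simp [Nat.pos_iff_ne_zero]) fun _ _ => rfl

variable [MeasurableSpace X]

theorem measurable_seqCons : Measurable (seqCons : X × (ℕ → X) → ℕ → X) :=
  measurable_pi_lambda _ fun k =>
    Nat.casesOn k measurable_fst fun k => (measurable_pi_apply k).comp measurable_snd

variable (μ : ℕ → Measure X) [∀ k, IsProbabilityMeasure (μ k)]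

theorem map_seqCons_prod_infinitePi :
    ((μ 0).prod (Measure.infinitePi fun k => μ (k + 1))).map seqCons = Measure.infinitePi μ := by
  refine Measure.eq_infinitePi μ fun s t ht => ?_
  rw [Measure.map_apply measurable_seqCons (.pi s.countable_toSet fun i _ => ht i),
    seqCons_preimage_pi, Measure.prod_prod, Measure.infinitePi_pi _ fun i _ => ht (i + 1),
    prod_eq_mul_prod_preimage_succ s]
  congr 1
  split_ifs with h0 <;> simp [h0]

theorem lintegral_infinitePi_eq_lintegral_seqCons {f : (ℕ → X) → ENNReal} (hf : Measurable f) :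
    ∫⁻ ω, f ω ∂Measure.infinitePi μ =
      ∫⁻ x, ∫⁻ ω, f (seqCons (x, ω)) ∂(Measure.infinitePi fun k => μ (k + 1)) ∂μ 0 := by
  rw [← map_seqCons_prod_infinitePi, lintegral_map hf measurable_seqCons,
    lintegral_prod (fun p => f (seqCons p)) (hf.comp measurable_seqCons).aemeasurable]

theorem lintegral_infinitePi_tsum_prod_range {g : ℕ → X → ENNReal} (hg : ∀ k, Measurable (g k)) :
    ∫⁻ ω, ∑' n : ℕ, ∏ k ∈ Finset.range n, g k (ω k) ∂Measure.infinitePi μ =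
      ∑' n : ℕ, ∏ k ∈ Finset.range n, ∫⁻ x, g k x ∂μ k := by
  have hm : ∀ k, Measurable fun ω : ℕ → X => g k (ω k) := fun k =>
    (hg k).comp (measurable_pi_apply k)
  rw [lintegral_tsum fun n => (Finset.measurable_fun_prod _ fun k _ => hm k).aemeasurable]
  refine tsum_congr fun n => ?_
  rw [ProbabilityTheory.lintegral_prod_eq_prod_lintegral_of_indepFun _ _
    (ProbabilityTheory.iIndepFun_infinitePi hg) hm]
  refine Finset.prod_congr rfl fun k _ => ?_
  rw [← Measure.infinitePi_map_eval μ k, lintegral_map (hg k) (measurable_pi_apply k)]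

end Product

/-! ### The renewal equation -/

/-- The time `τ_1 + ⋯ + τ_n` elapsed between the first collision and collision number `n + 1`. -/
def elapsed (ω : ℕ → ℝ) (n : ℕ) : ℝ := ∑ i ∈ Finset.range n, flightTime ω i

/-- The weight `exp (∑ θ_k ω_k² / 2)`, where the sum runs over the flights completed by the time `t`
after the first collision. It is written as a sum over the possible numbers of such flights, which
vanishes when there are infinitely many of them. -/
def pathWeight (θ : ℕ → ℝ) (t : ℝ) (ω : ℕ → ℝ) : ENNReal :=
  ∑' n : ℕ, if elapsed ω n ≤ t ∧ t < elapsed ω (n + 1) then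
    ENNReal.ofReal (Real.exp (∑ k ∈ Finset.range n, θ k * ω k ^ 2 / 2)) else 0

/-- The expectation of the path weight when the speeds are independent with laws `μ 0, μ 1, …`. -/
def pathMass (μ : ℕ → Measure ℝ) (θ : ℕ → ℝ) (t : ℝ) : ENNReal :=
  ∫⁻ ω, pathWeight θ t ω ∂Measure.infinitePi μ

/-- The weight `exp (θ x² / 2 - s τ)` of a flight of speed `x` and duration `τ = 1 / x`. -/
def flightWeight (θ s x : ℝ) : ENNReal := ENNReal.ofReal (Real.exp (θ * x ^ 2 / 2 - s / x))

/-- The expected weight of a flight whose speed has law `μ`: the joint Laplace transform of its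
energy and its duration. -/
def tiltMass (μ : Measure ℝ) (θ s : ℝ) : ENNReal := ∫⁻ x, flightWeight θ s x ∂μ

@[fun_prop]
theorem measurable_flightWeight (θ s : ℝ) : Measurable (flightWeight θ s) := by
  unfold flightWeight
  fun_prop

theorem flightWeight_pos (θ s x : ℝ) : 0 < flightWeight θ s x :=
  ENNReal.ofReal_pos.2 (Real.exp_pos _)

theorem measurable_elapsed (n : ℕ) : Measurable fun ω : ℕ → ℝ => elapsed ω n := by
  unfold elapsed flightTime
  fun_prop

theorem elapsed_seqCons_succ (x : ℝ) (ω : ℕ → ℝ) (n : ℕ) :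
    elapsed (seqCons (x, ω)) (n + 1) = elapsed ω n + 1 / x := by
  simp [elapsed, flightTime, Finset.sum_range_succ']

theorem measurable_pathWeight (θ : ℕ → ℝ) (t : ℝ) : Measurable (pathWeight θ t) :=
  Measurable.tsum fun n => Measurable.ite ((measurableSet_le (measurable_elapsed n)
    measurable_const).inter (measurableSet_lt measurable_const (measurable_elapsed (n + 1))))
    (by fun_prop) measurable_const

theorem pathWeight_seqCons (θ : ℕ → ℝ) (t x : ℝ) (ω : ℕ → ℝ) :
    pathWeight θ t (seqCons (x, ω)) = (if 0 ≤ t ∧ t < 1 / x then 1 else 0) +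
      flightWeight (θ 0) 0 x * pathWeight (fun k => θ (k + 1)) (t - 1 / x) ω := by
  rw [pathWeight, tsum_eq_zero_add' ENNReal.summable, pathWeight, ← ENNReal.tsum_mul_left]
  congr 1
  · simp [elapsed, flightTime]
  refine tsum_congr fun n => ?_
  simp only [elapsed_seqCons_succ, ← le_sub_iff_add_le, ← sub_lt_iff_lt_add, mul_ite, mul_zero]
  congr 1
  rw [flightWeight, ← ENNReal.ofReal_mul (Real.exp_pos _).le, ← Real.exp_add,
    Finset.sum_range_succ', add_comm]
  simp

section PathMass

variable {μ : ℕ → Measure ℝ} [∀ k, IsProbabilityMeasure (μ k)]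

theorem pathMass_eq_lintegral (θ : ℕ → ℝ) (t : ℝ) :
    pathMass μ θ t = ∫⁻ x, ((if 0 ≤ t ∧ t < 1 / x then 1 else 0) + flightWeight (θ 0) 0 x *
      pathMass (fun k => μ (k + 1)) (fun k => θ (k + 1)) (t - 1 / x)) ∂μ 0 := by
  rw [pathMass, lintegral_infinitePi_eq_lintegral_seqCons μ (measurable_pathWeight θ t)]
  refine lintegral_congr fun x => ?_
  simp_rw [pathWeight_seqCons]
  rw [lintegral_add_left measurable_const, lintegral_const_mul _ (measurable_pathWeight _ _),
    lintegral_const, measure_univ, mul_one, pathMass]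

theorem measure_Ioo_le_pathMass (θ : ℕ → ℝ) {t A : ℝ} (ht : 0 ≤ t) (htA : t ≤ A) :
    μ 0 (Set.Ioo 0 (1 / A)) ≤ pathMass μ θ t := by
  rw [pathMass_eq_lintegral, ← lintegral_indicator_one measurableSet_Ioo]
  refine lintegral_mono (Set.indicator_le fun x hx => ?_)
  rw [if_pos ⟨ht, htA.trans_lt (by simpa using one_div_lt_one_div_of_lt hx.1 hx.2)⟩]
  exact le_self_add

theorem mul_exp_mul_tiltMass_restrict_le_pathMass (θ : ℕ → ℝ) {s t : ℝ} {c : ENNReal} {A : Set ℝ}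
    (hA : MeasurableSet A) (h : ∀ x ∈ A, c * ENNReal.ofReal (Real.exp (s * (t - 1 / x))) ≤
      pathMass (fun k => μ (k + 1)) (fun k => θ (k + 1)) (t - 1 / x)) :
    c * ENNReal.ofReal (Real.exp (s * t)) * tiltMass ((μ 0).restrict A) (θ 0) s ≤
      pathMass μ θ t := by
  rw [tiltMass, ← lintegral_const_mul _ (measurable_flightWeight _ _), pathMass_eq_lintegral]
  refine (setLIntegral_mono' hA fun x hx => ?_).trans (setLIntegral_le_lintegral A _)
  calc c * ENNReal.ofReal (Real.exp (s * t)) * flightWeight (θ 0) s x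
      = flightWeight (θ 0) 0 x * (c * ENNReal.ofReal (Real.exp (s * (t - 1 / x)))) := by
        rw [mul_assoc, mul_left_comm _ c, flightWeight, flightWeight,
          ← ENNReal.ofReal_mul (Real.exp_pos _).le, ← ENNReal.ofReal_mul (Real.exp_pos _).le,
          ← Real.exp_add, ← Real.exp_add]
        congr 3
        ring
    _ ≤ _ := (mul_le_mul_right (h x hx) _).trans le_add_self

theorem pathMass_le_mul_tsum_prod_tiltMass (θ : ℕ → ℝ) (t : ℝ) {s : ℝ} (hs : 0 ≤ s) :
    pathMass μ θ t ≤ ENNReal.ofReal (Real.exp (s * t)) *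
      ∑' n : ℕ, ∏ k ∈ Finset.range n, tiltMass (μ k) (θ k) s := by
  simp only [tiltMass]
  rw [← lintegral_infinitePi_tsum_prod_range μ fun k => measurable_flightWeight _ _,
    ← lintegral_const_mul' _ _ ENNReal.ofReal_ne_top]
  refine lintegral_mono fun ω => ?_
  rw [← ENNReal.tsum_mul_left]
  refine ENNReal.tsum_le_tsum fun n => ?_
  split_ifs with h
  · simp only [flightWeight]
    rw [← ENNReal.ofReal_prod_of_nonneg fun _ _ => (Real.exp_pos _).le, ← Real.exp_sum,
      ← ENNReal.ofReal_mul (Real.exp_pos _).le, ← Real.exp_add]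
    refine ENNReal.ofReal_le_ofReal (Real.exp_le_exp.2 ?_)
    have hst := mul_le_mul_of_nonneg_left h.1 hs
    simp only [elapsed, flightTime, Finset.mul_sum, mul_one_div] at hst
    rw [Finset.sum_sub_distrib]
    linarith
  · exact zero_le

theorem ae_tendsto_elapsed_atTop
    (h : ∑' n : ℕ, ∏ k ∈ Finset.range n, tiltMass (μ k) 0 1 ≠ ⊤) :
    ∀ᵐ ω ∂Measure.infinitePi μ, Tendsto (elapsed ω) atTop atTop := by
  simp only [tiltMass] at h
  rw [← lintegral_infinitePi_tsum_prod_range μ fun _ => measurable_flightWeight 0 1] at h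
  have hm : Measurable fun ω : ℕ → ℝ =>
      ∑' n : ℕ, ∏ k ∈ Finset.range n, flightWeight 0 1 (ω k) :=
    Measurable.tsum fun n => by fun_prop
  filter_upwards [ae_lt_top hm h] with ω hω
  refine tendsto_atTop.2 fun R => ?_
  filter_upwards [(ENNReal.tendsto_atTop_zero_of_tsum_ne_top hω.ne).eventually_lt_const
    (ENNReal.ofReal_pos.2 (Real.exp_pos (-R)))] with n hn
  simp only [flightWeight] at hn
  rw [← ENNReal.ofReal_prod_of_nonneg fun _ _ => (Real.exp_pos _).le, ← Real.exp_sum,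
    ENNReal.ofReal_lt_ofReal_iff (Real.exp_pos _), Real.exp_lt_exp] at hn
  simp only [zero_mul, zero_div, zero_sub, Finset.sum_neg_distrib, neg_lt_neg_iff] at hn
  exact hn.le

end PathMass

theorem tsum_prod_range_ne_top {m : ℕ → ENNReal} {q : ENNReal} (hq : q < 1) (h0 : m 0 ≠ ⊤)
    (h : ∀ k, m k * m (k + 1) ≤ q) : ∑' n : ℕ, ∏ k ∈ Finset.range n, m k ≠ ⊤ := by
  have hstep : ∀ n, ∏ k ∈ Finset.range (n + 2), m k ≤ q * ∏ k ∈ Finset.range n, m k := fun n => by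
    rw [Finset.prod_range_succ, Finset.prod_range_succ, mul_assoc, mul_comm]
    exact mul_le_mul_left (h n) _
  have heven : ∀ n, ∏ k ∈ Finset.range (2 * n), m k ≤ q ^ n := fun n => by
    induction n with
    | zero => simp
    | succ n ih => exact (hstep (2 * n)).trans (pow_succ' q n ▸ mul_le_mul_right ih q)
  have hodd : ∀ n, ∏ k ∈ Finset.range (2 * n + 1), m k ≤ m 0 * q ^ n := fun n => by
    induction n with
    | zero => simp
    | succ n ih =>
      exact (hstep (2 * n + 1)).trans ((mul_le_mul_right ih q).trans_eq (by ring))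
  have hgeom : ∑' n : ℕ, q ^ n ≠ ⊤ := by
    rw [ENNReal.tsum_geometric, ENNReal.inv_ne_top]
    exact (tsub_pos_of_lt hq).ne'
  rw [← tsum_even_add_odd (f := fun n => ∏ k ∈ Finset.range n, m k)
    ENNReal.summable ENNReal.summable]
  refine ENNReal.add_ne_top.2 ⟨ne_top_of_le_ne_top hgeom (ENNReal.tsum_le_tsum heven),
    ne_top_of_le_ne_top (ENNReal.mul_ne_top h0 hgeom) ?_⟩
  rw [← ENNReal.tsum_mul_left]
  exact ENNReal.tsum_le_tsum hodd

section LowerBound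

variable {μ : ℕ → Measure ℝ} [∀ k, IsProbabilityMeasure (μ k)] {θ : ℕ → ℝ}

theorem mul_exp_le_pathMass_of_le_mul_tiltMass {c : ℕ → ENNReal} {s A : ℝ} (hA : 0 < A)
    (hbase : ∀ k t, 0 ≤ t → t ≤ A → c k * ENNReal.ofReal (Real.exp (s * t)) ≤
      pathMass (fun i => μ (i + k)) (fun i => θ (i + k)) t)
    (hstep : ∀ k, c k ≤ c (k + 1) * tiltMass ((μ k).restrict (Set.Icc (1 / A) A)) (θ k) s)
    (k : ℕ) {t : ℝ} (ht : 0 ≤ t) :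
    c k * ENNReal.ofReal (Real.exp (s * t)) ≤
      pathMass (fun i => μ (i + k)) (fun i => θ (i + k)) t := by
  obtain ⟨n, hn⟩ := exists_nat_ge (t / (1 / A))
  rw [div_le_iff₀ (one_div_pos.2 hA)] at hn
  induction n generalizing k t with
  | zero =>
    refine hbase k t ht (hn.trans ?_)
    simpa using hA.le
  | succ n ih =>
    rcases le_or_gt t A with htA | htA
    · exact hbase k t ht htA
    have hwindow : ∀ x ∈ Set.Icc (1 / A) A, 0 ≤ t - 1 / x ∧ t - 1 / x ≤ n * (1 / A) := by
      intro x hx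
      have hx0 : 0 < x := (one_div_pos.2 hA).trans_le hx.1
      have hxA : 1 / x ≤ A := (one_div_le hA hx0).1 hx.1
      have hAx : 1 / A ≤ 1 / x := one_div_le_one_div_of_le hx0 hx.2
      push_cast at hn
      constructor <;> linarith
    have hrenewal := mul_exp_mul_tiltMass_restrict_le_pathMass (μ := fun i => μ (i + k))
      (fun i => θ (i + k)) (s := s) (t := t) (c := c (k + 1)) measurableSet_Icc fun x hx => by
        simpa only [add_right_comm _ 1 k, ← add_assoc] using
          ih (k + 1) (hwindow x hx).1 (hwindow x hx).2
    refine le_trans ?_ hrenewal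
    rw [mul_right_comm, zero_add]
    exact mul_le_mul_left (hstep k) _

/-- The factors `min 1 M` absorb a tilted mass `M` that may be smaller than one: when the products
of two successive masses are at least one, `min 1 (M k) ≤ M k * min 1 (M (k + 1))`. -/
theorem exists_mul_exp_le_pathMass {s A : ℝ} (hA : 0 < A)
    (hslow : ∃ w ≠ 0, ∀ k, w ≤ μ k (Set.Ioo 0 (1 / A)))
    (hmass : ∀ k, 1 ≤ tiltMass ((μ k).restrict (Set.Icc (1 / A) A)) (θ k) s *
      tiltMass ((μ (k + 1)).restrict (Set.Icc (1 / A) A)) (θ (k + 1)) s) :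
    ∃ c : ENNReal, c ≠ 0 ∧ c ≠ ⊤ ∧ ∀ t : ℝ, 0 ≤ t →
      c * ENNReal.ofReal (Real.exp (s * t)) ≤ pathMass μ θ t := by
  obtain ⟨w, hw0, hw⟩ := hslow
  set M : ℕ → ENNReal := fun k => tiltMass ((μ k).restrict (Set.Icc (1 / A) A)) (θ k) s
  set e := ENNReal.ofReal (Real.exp (-(|s| * A)))
  have hwtop : w ≠ ⊤ := ne_top_of_le_ne_top (measure_ne_top _ _) (hw 0)
  have hM0 : M 0 ≠ 0 := fun h0 =>
    not_le.2 one_pos ((hmass 0).trans_eq (mul_eq_zero_of_left h0 _))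
  refine ⟨w * e * min 1 (M 0), mul_ne_zero (mul_ne_zero hw0 (ENNReal.ofReal_pos.2
    (Real.exp_pos _)).ne') (lt_min one_pos (pos_iff_ne_zero.2 hM0)).ne', ENNReal.mul_ne_top
    (ENNReal.mul_ne_top hwtop ENNReal.ofReal_ne_top)
    (ne_top_of_le_ne_top ENNReal.one_ne_top (min_le_left _ _)), fun t ht => ?_⟩
  refine mul_exp_le_pathMass_of_le_mul_tiltMass (c := fun k => w * e * min 1 (M k)) hA
    (fun k t ht htA => ?_) (fun k => ?_) 0 ht
  · have hexp : e * ENNReal.ofReal (Real.exp (s * t)) ≤ 1 := by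
      rw [← ENNReal.ofReal_mul (Real.exp_pos _).le, ← Real.exp_add]
      refine ENNReal.ofReal_le_one.2 (Real.exp_le_one_iff.2 ?_)
      nlinarith [le_abs_self s, abs_nonneg s]
    have hslow := measure_Ioo_le_pathMass (μ := fun i => μ (i + k)) (fun i => θ (i + k)) ht htA
    rw [zero_add] at hslow
    calc w * e * min 1 (M k) * ENNReal.ofReal (Real.exp (s * t))
        = w * (e * ENNReal.ofReal (Real.exp (s * t))) * min 1 (M k) := by ring
      _ ≤ w * 1 * 1 := by gcongr; exact min_le_left _ _
      _ ≤ _ := by simpa only [mul_one] using (hw k).trans hslow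
  · change w * e * min 1 (M k) ≤ w * e * min 1 (M (k + 1)) * M k
    rw [mul_assoc (w * e)]
    refine mul_le_mul_right ?_ _
    rw [min_mul_of_nonneg _ _ zero_le, one_mul, mul_comm]
    exact le_min (min_le_right _ _) ((min_le_left _ _).trans (hmass k))

end LowerBound

theorem tendsto_one_div_mul_log_mul_exp {C : ENNReal} (h0 : C ≠ 0) (htop : C ≠ ⊤) (s a : ℝ) :
    Tendsto (fun t : ℝ => ((1 / t : ℝ) : EReal) *
      ENNReal.log (C * ENNReal.ofReal (Real.exp (s * (t - a))))) atTop (𝓝 (s : EReal)) := by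
  have hC := ENNReal.toReal_pos h0 htop
  have hlim : Tendsto (fun t : ℝ => (Real.log C.toReal - s * a) / t + s) atTop (𝓝 s) := by
    simpa using (tendsto_const_nhds.div_atTop tendsto_id).add_const s
  refine ((continuous_coe_real_ereal.tendsto s).comp hlim).congr' ?_
  filter_upwards [eventually_gt_atTop 0] with t ht
  rw [Function.comp_apply, ← ENNReal.ofReal_toReal htop, ← ENNReal.ofReal_mul hC.le,
    ENNReal.log_ofReal_of_pos (by positivity), ← EReal.coe_mul,
    Real.log_mul hC.ne' (Real.exp_pos _).ne', Real.log_exp, ENNReal.ofReal_toReal htop]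
  congr 1
  field_simp
  ring

section TiltMass

variable {μ : Measure ℝ}

theorem tiltMass_ne_zero [NeZero μ] (θ s : ℝ) : tiltMass μ θ s ≠ 0 := by
  rw [tiltMass, Ne, lintegral_eq_zero_iff (measurable_flightWeight θ s)]
  intro h
  obtain ⟨x, hx⟩ := h.exists
  exact (flightWeight_pos θ s x).ne' hx

theorem antitone_tiltMass (hμ : ∀ᵐ x ∂μ, 0 < x) (θ : ℝ) : Antitone (tiltMass μ θ) := by
  intro s s' hs
  refine lintegral_mono_ae ?_
  filter_upwards [hμ] with x hx
  unfold flightWeight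
  gcongr

theorem tiltMass_lt_tiltMass [NeZero μ] (hμ : ∀ᵐ x ∂μ, 0 < x) {θ s s' : ℝ} (hs : s < s')
    (h : tiltMass μ θ s' ≠ ⊤) : tiltMass μ θ s' < tiltMass μ θ s := by
  refine lintegral_strict_mono (NeZero.ne μ) (measurable_flightWeight θ s).aemeasurable h ?_
  filter_upwards [hμ] with x hx
  refine (ENNReal.ofReal_lt_ofReal_iff (Real.exp_pos _)).2 (Real.exp_lt_exp.2 ?_)
  gcongr

theorem tendsto_tiltMass_restrict_Icc (hμ : ∀ᵐ x ∂μ, 0 < x) (θ s : ℝ) :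
    Tendsto (fun n : ℕ => tiltMass (μ.restrict (Set.Icc (1 / ((n : ℝ) + 1)) (n + 1))) θ s) atTop
      (𝓝 (tiltMass μ θ s)) := by
  have hcov : AECover μ atTop fun n : ℕ => Set.Icc (1 / ((n : ℝ) + 1)) ((n : ℝ) + 1) := by
    refine ⟨?_, fun n => measurableSet_Icc⟩
    filter_upwards [hμ] with x hx
    have hleft := tendsto_one_div_add_atTop_nhds_zero_nat (𝕜 := ℝ)
    have hright : Tendsto (fun n : ℕ => (n : ℝ) + 1) atTop atTop :=
      tendsto_atTop_add_const_right _ _ tendsto_natCast_atTop_atTop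
    filter_upwards [hleft.eventually_lt_const hx, hright.eventually_gt_atTop x] with n hn hn'
    exact ⟨hn.le, hn'.le⟩
  exact hcov.lintegral_tendsto_of_nat (measurable_flightWeight θ s).aemeasurable

end TiltMass

theorem ae_pos_wallLaw (β : ℝ) : ∀ᵐ x ∂wallLaw β, 0 < x :=
  (withDensity_absolutelyContinuous _ _).ae_le (ae_restrict_mem measurableSet_Ioi)

theorem wallLaw_Ioo_pos {β b : ℝ} (hβ : 0 < β) (hb : 0 < b) : 0 < wallLaw β (Set.Ioo 0 b) := by
  rw [wallLaw, withDensity_apply _ measurableSet_Ioo, Measure.restrict_restrict measurableSet_Ioo,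
    setLIntegral_pos_iff (by fun_prop)]
  have hsub : Set.Ioo 0 b ⊆ Function.support (fun p : ℝ =>
      ENNReal.ofReal (β * p * Real.exp (-(β * p ^ 2 / 2)))) ∩ (Set.Ioo 0 b ∩ Set.Ioi 0) :=
    fun x hx => ⟨(ENNReal.ofReal_pos.2 (mul_pos (mul_pos hβ hx.1) (Real.exp_pos _))).ne', hx, hx.1⟩
  exact (by simpa using hb : 0 < volume (Set.Ioo 0 b)).trans_le (measure_mono hsub)

theorem tiltMass_wallLaw {β : ℝ} (hβ : 0 ≤ β) (θ s : ℝ) : tiltMass (wallLaw β) θ s =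
    ∫⁻ x in Set.Ioi 0, ENNReal.ofReal (β * x * Real.exp ((θ - β) * x ^ 2 / 2 - s / x)) := by
  rw [tiltMass, wallLaw, lintegral_withDensity_eq_lintegral_mul _ (by fun_prop)
    (measurable_flightWeight θ s)]
  refine setLIntegral_congr_fun measurableSet_Ioi fun x (hx : 0 < x) => ?_
  rw [Pi.mul_apply, flightWeight, ← ENNReal.ofReal_mul (by positivity), mul_assoc, ← Real.exp_add]
  ring_nf

theorem tiltMass_wallLaw_eq_mul {β θ : ℝ} (hβ : 0 ≤ β) (hθ : θ < β) (s : ℝ) :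
    tiltMass (wallLaw β) θ s =
      ENNReal.ofReal (β / (β - θ)) * tiltMass (wallLaw (β - θ)) 0 s := by
  have hγ : 0 < β - θ := sub_pos.2 hθ
  rw [tiltMass_wallLaw hβ, tiltMass_wallLaw hγ.le, ← lintegral_const_mul _ (by fun_prop)]
  refine lintegral_congr fun x => ?_
  rw [← ENNReal.ofReal_mul (by positivity), zero_sub, neg_sub, ← mul_assoc, ← mul_assoc,
    div_mul_cancel₀ _ hγ.ne']

theorem tiltMass_wallLaw_eq_top_of_le {β θ : ℝ} (hβ : 0 < β) (h : β ≤ θ) (s : ℝ) :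
    tiltMass (wallLaw β) θ s = ⊤ := by
  rw [tiltMass_wallLaw hβ.le, eq_top_iff]
  calc ⊤ = ∫⁻ _ in Set.Ioi (1 : ℝ), ENNReal.ofReal (β * Real.exp (-|s|)) := by
        rw [setLIntegral_const, Real.volume_Ioi, ENNReal.mul_top]
        exact (ENNReal.ofReal_pos.2 (by positivity)).ne'
    _ ≤ ∫⁻ x in Set.Ioi 1,
        ENNReal.ofReal (β * x * Real.exp ((θ - β) * x ^ 2 / 2 - s / x)) := by
        refine setLIntegral_mono' measurableSet_Ioi fun x (hx : 1 < x) => ?_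
        have hsx : s / x ≤ |s| := (le_abs_self _).trans (by
          rw [abs_div, abs_of_pos (one_pos.trans hx)]
          exact div_le_self (abs_nonneg s) hx.le)
        have hθx : 0 ≤ (θ - β) * x ^ 2 / 2 := by have := sub_nonneg.2 h; positivity
        gcongr
        · exact le_mul_of_one_le_right hβ.le hx.le
        · linarith
    _ ≤ _ := lintegral_mono_set (Set.Ioi_subset_Ioi zero_le_one)

theorem setLIntegral_Ioc_ofReal_inv_eq_top {c : ℝ} (hc : 0 < c) :
    ∫⁻ x in Set.Ioc 0 1, ENNReal.ofReal (c * x⁻¹) = ⊤ := by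
  by_contra h
  have hint : IntegrableOn (fun x : ℝ => c * x⁻¹) (Set.Ioc 0 1) := by
    refine ⟨by fun_prop, (hasFiniteIntegral_iff_ofReal ?_).2 (lt_top_iff_ne_top.2 h)⟩
    filter_upwards [ae_restrict_mem measurableSet_Ioc] with x hx
    exact mul_nonneg hc.le (inv_nonneg.2 hx.1.le)
  rw [← intervalIntegrable_iff_integrableOn_Ioc_of_le zero_le_one] at hint
  have hinv := hint.const_mul c⁻¹
  simp [inv_mul_cancel_left₀ hc.ne', intervalIntegrable_inv_iff] at hinv

/-- Slow particles have flight times without exponential moments: the density of the flight time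
`1 / x` decays only polynomially. -/
theorem tiltMass_wallLaw_eq_top_of_neg {β s : ℝ} (hβ : 0 < β) (θ : ℝ) (hs : s < 0) :
    tiltMass (wallLaw β) θ s = ⊤ := by
  rw [tiltMass_wallLaw hβ.le, eq_top_iff,
    ← setLIntegral_Ioc_ofReal_inv_eq_top (c := β * (Real.exp (-|θ - β|) * (s ^ 2 / 2)))
      (by have := sq_pos_of_neg hs; positivity)]
  refine le_trans (setLIntegral_mono' measurableSet_Ioc fun x hx => ?_)
    (lintegral_mono_set Set.Ioc_subset_Ioi_self)
  obtain ⟨hx0, hx1⟩ := hx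
  have hquad : (s / x) ^ 2 / 2 ≤ Real.exp (-(s / x)) := by
    have hpos : 0 ≤ -(s / x) := by rw [← neg_div]; exact div_nonneg (neg_pos.2 hs).le hx0.le
    linarith [Real.quadratic_le_exp_of_nonneg hpos, neg_sq (s / x)]
  have hbdd : -|θ - β| ≤ (θ - β) * x ^ 2 / 2 := by
    have hx2 : x ^ 2 ≤ 1 := pow_le_one₀ hx0.le hx1
    nlinarith [neg_abs_le (θ - β), abs_nonneg (θ - β), sq_nonneg x]
  refine ENNReal.ofReal_le_ofReal ?_
  calc β * (Real.exp (-|θ - β|) * (s ^ 2 / 2)) * x⁻¹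
      = β * x * (Real.exp (-|θ - β|) * ((s / x) ^ 2 / 2)) := by field_simp
    _ ≤ β * x * (Real.exp ((θ - β) * x ^ 2 / 2) * Real.exp (-(s / x))) := by gcongr
    _ = _ := by rw [← Real.exp_add, sub_eq_add_neg (_ / 2)]

theorem tiltMass_wallLaw_zero_one_lt_one {β : ℝ} (hβ : 0 < β) : tiltMass (wallLaw β) 0 1 < 1 := by
  have := isProbabilityMeasure_wallLaw hβ
  have hzero : tiltMass (wallLaw β) 0 0 = 1 := by simp [tiltMass, flightWeight]
  rw [← hzero]
  refine tiltMass_lt_tiltMass (ae_pos_wallLaw β) one_pos (ne_top_of_le_ne_top ENNReal.one_ne_top ?_)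
  exact (antitone_tiltMass (ae_pos_wallLaw β) 0 zero_le_one).trans_eq hzero

/-! ### The growth rate -/

theorem exists_forall_le_iff_le {u : ℕ → ℝ} (hu : StrictMono u) (hu' : Tendsto u atTop atTop)
    {t : ℝ} (ht : u 0 ≤ t) : ∃ N, ∀ k, u k ≤ t ↔ k ≤ N := by
  classical
  have hex : ∃ n, t < u (n + 1) :=
    (((tendsto_add_atTop_iff_nat 1).2 hu').eventually_gt_atTop t).exists
  refine ⟨Nat.find hex, fun k => ⟨fun hk => ?_, fun hk => ?_⟩⟩
  · exact Nat.lt_succ_iff.1 (hu.lt_iff_lt.1 (hk.trans_lt (Nat.find_spec hex)))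
  · cases k with
    | zero => exact ht
    | succ k => exact not_lt.1 (Nat.find_min hex hk)

theorem pathWeight_eq_of_forall_elapsed_le_iff (θ : ℕ → ℝ) {t : ℝ} {ω : ℕ → ℝ} {N : ℕ}
    (hN : ∀ k, elapsed ω k ≤ t ↔ k ≤ N) : pathWeight θ t ω =
      ENNReal.ofReal (Real.exp (∑ k ∈ Finset.range N, θ k * ω k ^ 2 / 2)) := by
  have hiff : ∀ n, (elapsed ω n ≤ t ∧ t < elapsed ω (n + 1)) ↔ n = N := fun n => by
    rw [hN, ← not_le, hN]
    omega
  simp_rw [pathWeight, hiff]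
  exact tsum_ite_eq N _

/-- The time `S_0` of the first collision. -/
def firstCollision (q₀ p₀ : ℝ) : ℝ := ((Real.sign p₀ + 1) / 2 - q₀) / p₀

/-- The law of the speed of flight number `k + 1`. -/
def flightLaw (βL βR p₀ : ℝ) (k : ℕ) : Measure ℝ := wallLaw (wallBeta βL βR (flightSign p₀ k))

/-- The coefficient of `ω_k² / 2` in the exponent `l J`. -/
def flightTilt (p₀ l : ℝ) (k : ℕ) : ℝ := l * flightSign p₀ (k + 1)

section FlightSign

variable {p₀ : ℝ} (hp₀ : p₀ ≠ 0)

include hp₀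

theorem flightSign_eq_neg_one_or_one (k : ℕ) : flightSign p₀ k = -1 ∨ flightSign p₀ k = 1 := by
  rcases neg_one_pow_eq_or ℝ k with hk | hk <;>
    rcases Real.sign_apply_eq_of_ne_zero p₀ hp₀ with h | h <;> simp [flightSign, hk, h]

theorem energyCurrent_eq_of_forall_elapsed_le_iff {q₀ t : ℝ} {ω : ℕ → ℝ} {N : ℕ}
    (hN : ∀ k, elapsed ω k ≤ t - firstCollision q₀ p₀ ↔ k ≤ N) : energyCurrent q₀ p₀ ω t =
      1 / 2 * ∑ k ∈ Finset.range N, flightSign p₀ (k + 1) * ω k ^ 2 := by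
  have hcollision : ∀ k, collisionTime q₀ p₀ ω (k + 1) ≤ t ↔ k ∈ Finset.range N := fun k => by
    rw [Finset.mem_range, ← Nat.succ_le_iff, ← hN, le_sub_iff_add_le']
    rfl
  simp_rw [energyCurrent, hcollision]
  rw [tsum_eq_sum (s := Finset.range N) fun k hk => if_neg hk, Finset.sum_ite_mem,
    Finset.inter_self]
  congr 1
  refine Finset.sum_congr rfl fun k _ => ?_
  have hsign : flightSign p₀ (k + 1) ^ 2 = 1 := by
    rcases flightSign_eq_neg_one_or_one hp₀ (k + 1) with h | h <;> simp [h]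
  rw [flightVelocity, flightTime, div_pow, hsign, div_pow, one_pow, one_div_one_div, mul_comm]

theorem ofReal_exp_energyCurrent (l : ℝ) {q₀ t : ℝ} (ht : firstCollision q₀ p₀ ≤ t) {ω : ℕ → ℝ}
    (hω : ∀ k, 0 < ω k) (hω' : Tendsto (elapsed ω) atTop atTop) :
    ENNReal.ofReal (Real.exp (l * energyCurrent q₀ p₀ ω t)) =
      pathWeight (flightTilt p₀ l) (t - firstCollision q₀ p₀) ω := by
  have hmono : StrictMono (elapsed ω) := strictMono_nat_of_lt_succ fun n => by
    rw [elapsed, elapsed, Finset.sum_range_succ, flightTime]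
    exact lt_add_of_pos_right _ (one_div_pos.2 (hω n))
  obtain ⟨N, hN⟩ := exists_forall_le_iff_le hmono hω'
    (show elapsed ω 0 ≤ t - firstCollision q₀ p₀ by simpa [elapsed] using ht)
  rw [pathWeight_eq_of_forall_elapsed_le_iff _ hN, energyCurrent_eq_of_forall_elapsed_le_iff hp₀ hN,
    Finset.mul_sum, Finset.mul_sum]
  congr 2
  refine Finset.sum_congr rfl fun k _ => ?_
  rw [flightTilt]
  ring

theorem mul_wallBeta_flightSign_succ (F : ℝ → ℝ → ENNReal) (βL βR l : ℝ) (k : ℕ) :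
    F (wallBeta βL βR (flightSign p₀ k)) (flightTilt p₀ l k) *
      F (wallBeta βL βR (flightSign p₀ (k + 1))) (flightTilt p₀ l (k + 1)) =
      F βL l * F βR (-l) := by
  have hsucc : ∀ k, flightSign p₀ (k + 1) = -flightSign p₀ k := fun k => by
    simp [flightSign, pow_succ]
  simp only [flightTilt, hsucc, neg_neg]
  rcases flightSign_eq_neg_one_or_one hp₀ k with h | h <;> norm_num [h, wallBeta, mul_comm]

end FlightSign

/-- The mass of two successive flights, one from each wall, tilted by the exponential of `l` times
the energy exchanged minus `s` times the duration. -/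
def cycleMass (βL βR l s : ℝ) : ENNReal :=
  tiltMass (wallLaw βL) l s * tiltMass (wallLaw βR) (-l) s

/-- The growth rate of `E (exp (l J[0,t]))`: the threshold in `s` at which the cycle mass crosses
one, equal to `⊤` if no cycle mass is smaller than one. -/
def growthRate (βL βR l : ℝ) : EReal := ⨅ (s : ℝ) (_ : cycleMass βL βR l s < 1), (s : EReal)

section WallLaws

variable {βL βR : ℝ} (hL : 0 < βL) (hR : 0 < βR)

include hL hR

theorem wallBeta_pos (σ : ℝ) : 0 < wallBeta βL βR σ := by
  unfold wallBeta
  split_ifs <;> assumption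

theorem isProbabilityMeasure_flightLaw (p₀ : ℝ) (k : ℕ) :
    IsProbabilityMeasure (flightLaw βL βR p₀ k) :=
  isProbabilityMeasure_wallLaw (wallBeta_pos hL hR _)

theorem ae_pos_and_tendsto_elapsed (p₀ : ℝ) :
    ∀ᵐ ω ∂Measure.infinitePi (flightLaw βL βR p₀),
      (∀ k, 0 < ω k) ∧ Tendsto (elapsed ω) atTop atTop := by
  have := isProbabilityMeasure_flightLaw hL hR p₀
  refine (ae_all_iff.2 fun k => (measurePreserving_eval_infinitePi
    (flightLaw βL βR p₀) k).quasiMeasurePreserving.ae (ae_pos_wallLaw _)).and ?_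
  set q := max (tiltMass (wallLaw βL) 0 1) (tiltMass (wallLaw βR) 0 1)
  have hq : q < 1 :=
    max_lt (tiltMass_wallLaw_zero_one_lt_one hL) (tiltMass_wallLaw_zero_one_lt_one hR)
  have hle : ∀ k, tiltMass (flightLaw βL βR p₀ k) 0 1 ≤ q := fun k => by
    rw [flightLaw, wallBeta]
    split_ifs
    exacts [le_max_right _ _, le_max_left _ _]
  refine ae_tendsto_elapsed_atTop (tsum_prod_range_ne_top hq
    (ne_top_of_le_ne_top hq.ne_top (hle 0)) fun k => ?_)
  exact (mul_le_mul' (hle k) (hle (k + 1))).trans (mul_le_of_le_one_right' hq.le)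

theorem scaledCumulant_eq {q₀ p₀ : ℝ} (hp₀ : p₀ ≠ 0) (l : ℝ) {t : ℝ}
    (ht : firstCollision q₀ p₀ ≤ t) :
    scaledCumulant q₀ p₀ βL βR l t = ((1 / t : ℝ) : EReal) * ENNReal.log
      (pathMass (flightLaw βL βR p₀) (flightTilt p₀ l) (t - firstCollision q₀ p₀)) := by
  rw [scaledCumulant, pathMass]
  congr 2
  refine lintegral_congr_ae ?_
  filter_upwards [ae_pos_and_tendsto_elapsed hL hR p₀] with ω hω
  exact ofReal_exp_energyCurrent hp₀ l ht hω.1 hω.2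

variable {l s : ℝ}

theorem tiltMass_ne_top_of_cycleMass_ne_top (h : cycleMass βL βR l s ≠ ⊤) :
    tiltMass (wallLaw βL) l s ≠ ⊤ ∧ tiltMass (wallLaw βR) (-l) s ≠ ⊤ := by
  have := isProbabilityMeasure_wallLaw hL
  have := isProbabilityMeasure_wallLaw hR
  refine ⟨fun htop => h ?_, fun htop => h ?_⟩
  · rw [cycleMass, htop, ENNReal.top_mul (tiltMass_ne_zero _ _)]
  · rw [cycleMass, htop, ENNReal.mul_top (tiltMass_ne_zero _ _)]

theorem cycleMass_eq_top_of_neg (hs : s < 0) : cycleMass βL βR l s = ⊤ := by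
  rw [cycleMass, tiltMass_wallLaw_eq_top_of_neg hL l hs,
    tiltMass_wallLaw_eq_top_of_neg hR (-l) hs, ENNReal.top_mul_top]

theorem nonneg_of_cycleMass_lt_one (h : cycleMass βL βR l s < 1) : 0 ≤ s :=
  not_lt.1 fun hs => (h.trans ENNReal.one_lt_top).ne (cycleMass_eq_top_of_neg hL hR hs)

theorem one_lt_cycleMass_of_lt {s' : ℝ} (hs : s < s') (h : 1 ≤ cycleMass βL βR l s') :
    1 < cycleMass βL βR l s := by
  have := isProbabilityMeasure_wallLaw hL
  have := isProbabilityMeasure_wallLaw hR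
  rcases eq_or_ne (cycleMass βL βR l s) ⊤ with htop | htop
  · exact htop ▸ ENNReal.one_lt_top
  obtain ⟨hfinL, hfinR⟩ := tiltMass_ne_top_of_cycleMass_ne_top hL hR htop
  refine h.trans_lt (ENNReal.mul_lt_mul ?_ ?_)
  · exact tiltMass_lt_tiltMass (ae_pos_wallLaw _) hs
      (ne_top_of_le_ne_top hfinL (antitone_tiltMass (ae_pos_wallLaw _) _ hs.le))
  · exact tiltMass_lt_tiltMass (ae_pos_wallLaw _) hs
      (ne_top_of_le_ne_top hfinR (antitone_tiltMass (ae_pos_wallLaw _) _ hs.le))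

theorem exists_pathMass_le_mul_exp {p₀ : ℝ} (hp₀ : p₀ ≠ 0) (h : cycleMass βL βR l s < 1) :
    ∃ C : ENNReal, C ≠ 0 ∧ C ≠ ⊤ ∧ ∀ t : ℝ, pathMass (flightLaw βL βR p₀) (flightTilt p₀ l) t ≤
      C * ENNReal.ofReal (Real.exp (s * t)) := by
  have := isProbabilityMeasure_flightLaw hL hR p₀
  set m : ℕ → ENNReal := fun k => tiltMass (flightLaw βL βR p₀ k) (flightTilt p₀ l k) s
  have hcycle : ∀ k, m k * m (k + 1) = cycleMass βL βR l s :=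
    mul_wallBeta_flightSign_succ hp₀ (fun β θ => tiltMass (wallLaw β) θ s) βL βR l
  have hm0 : m 0 ≠ ⊤ := fun htop => h.ne_top <| by
    rw [← hcycle 0, htop, ENNReal.top_mul (tiltMass_ne_zero _ _)]
  refine ⟨∑' n : ℕ, ∏ k ∈ Finset.range n, m k, fun hzero => ?_,
    tsum_prod_range_ne_top h hm0 fun k => (hcycle k).le, fun t => ?_⟩
  · simpa using ENNReal.tsum_eq_zero.1 hzero 0
  · rw [mul_comm]
    exact pathMass_le_mul_tsum_prod_tiltMass _ t (nonneg_of_cycleMass_lt_one hL hR h)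

theorem exists_mul_exp_le_pathMass_of_one_lt_cycleMass {p₀ : ℝ} (hp₀ : p₀ ≠ 0)
    (h : 1 < cycleMass βL βR l s) :
    ∃ c : ENNReal, c ≠ 0 ∧ c ≠ ⊤ ∧ ∀ t : ℝ, 0 ≤ t → c * ENNReal.ofReal (Real.exp (s * t)) ≤
      pathMass (flightLaw βL βR p₀) (flightTilt p₀ l) t := by
  have := isProbabilityMeasure_flightLaw hL hR p₀
  have := isProbabilityMeasure_wallLaw hL
  have := isProbabilityMeasure_wallLaw hR
  obtain ⟨n, hn⟩ := ((ENNReal.Tendsto.mul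
    (tendsto_tiltMass_restrict_Icc (ae_pos_wallLaw βL) l s) (Or.inl (tiltMass_ne_zero _ _))
    (tendsto_tiltMass_restrict_Icc (ae_pos_wallLaw βR) (-l) s)
    (Or.inl (tiltMass_ne_zero _ _))).eventually_const_lt h).exists
  have hA : (0 : ℝ) < n + 1 := by positivity
  set slow : ℝ → ENNReal := fun β => wallLaw β (Set.Ioo 0 (1 / ((n : ℝ) + 1)))
  refine exists_mul_exp_le_pathMass hA ⟨min (slow βL) (slow βR), (lt_min
    (wallLaw_Ioo_pos hL (one_div_pos.2 hA)) (wallLaw_Ioo_pos hR (one_div_pos.2 hA))).ne',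
    fun k => ?_⟩ fun k => ?_
  · rw [flightLaw, wallBeta]
    split_ifs
    exacts [min_le_right _ _, min_le_left _ _]
  · exact hn.le.trans_eq (mul_wallBeta_flightSign_succ hp₀
      (fun β θ => tiltMass ((wallLaw β).restrict (Set.Icc (1 / ((n : ℝ) + 1)) (n + 1))) θ s)
      βL βR l k).symm

theorem tendsto_scaledCumulant (q₀ : ℝ) {p₀ : ℝ} (hp₀ : p₀ ≠ 0) (l : ℝ) :
    Tendsto (fun t : ℝ => scaledCumulant q₀ p₀ βL βR l t) atTop (𝓝 (growthRate βL βR l)) := by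
  set a := firstCollision q₀ p₀
  refine tendsto_order.2 ⟨fun b hb => ?_, fun b hb => ?_⟩
  · obtain ⟨s, hbs, hs⟩ := EReal.lt_iff_exists_real_btwn.1 hb
    obtain ⟨s', hss', hs'⟩ := EReal.lt_iff_exists_real_btwn.1 hs
    have hmass : 1 < cycleMass βL βR l s := one_lt_cycleMass_of_lt hL hR
      (EReal.coe_lt_coe_iff.1 hss') (not_lt.1 fun hlt => hs'.not_ge (iInf₂_le s' hlt))
    obtain ⟨c, hc0, hctop, hc⟩ :=
      exists_mul_exp_le_pathMass_of_one_lt_cycleMass hL hR hp₀ hmass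
    filter_upwards [(tendsto_one_div_mul_log_mul_exp hc0 hctop s a).eventually_const_lt hbs,
      eventually_ge_atTop a, eventually_gt_atTop 0] with t ht hta ht0
    rw [scaledCumulant_eq hL hR hp₀ l hta]
    exact ht.trans_le (mul_le_mul_of_nonneg_left (ENNReal.log_le_log (hc _ (sub_nonneg.2 hta)))
      (EReal.coe_nonneg.2 (one_div_pos.2 ht0).le))
  · obtain ⟨s, hs⟩ := iInf_lt_iff.1 hb
    obtain ⟨hmass, hsb⟩ := iInf_lt_iff.1 hs
    obtain ⟨C, hC0, hCtop, hC⟩ := exists_pathMass_le_mul_exp hL hR hp₀ hmass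
    filter_upwards [(tendsto_one_div_mul_log_mul_exp hC0 hCtop s a).eventually_lt_const hsb,
      eventually_ge_atTop a, eventually_gt_atTop 0] with t ht hta ht0
    rw [scaledCumulant_eq hL hR hp₀ l hta]
    exact (mul_le_mul_of_nonneg_left (ENNReal.log_le_log (hC _))
      (EReal.coe_nonneg.2 (one_div_pos.2 ht0).le)).trans_lt ht

theorem cumulantGF_eq_growthRate (q₀ : ℝ) {p₀ : ℝ} (hp₀ : p₀ ≠ 0) (l : ℝ) :
    cumulantGF q₀ p₀ l βL βR = growthRate βL βR l :=
  (tendsto_scaledCumulant hL hR q₀ hp₀ l).limsup_eq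

end WallLaws

/-! ### The Laplace transform of the flight time -/

theorem lintegral_wallLaw {γ : ℝ} (hγ : 0 ≤ γ) {g : ℝ → ℝ} (hg : Measurable g) :
    ∫⁻ x, ENNReal.ofReal (g x) ∂wallLaw γ =
      ∫⁻ x in Set.Ioi 0, ENNReal.ofReal (γ * x * Real.exp (-(γ * x ^ 2 / 2)) * g x) := by
  rw [wallLaw, lintegral_withDensity_eq_lintegral_mul _ (by fun_prop) (by fun_prop)]
  refine setLIntegral_congr_fun measurableSet_Ioi fun x (hx : 0 < x) => ?_
  exact (ENNReal.ofReal_mul (by positivity)).symm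

section Moments

variable {γ r : ℝ} (hγ : 0 < γ)

include hγ

theorem lintegral_rpow_wallLaw (hr : -2 < r) : ∫⁻ x, ENNReal.ofReal (x ^ r) ∂wallLaw γ =
    ENNReal.ofReal ((γ / 2) ^ (-r / 2) * Real.Gamma (r / 2 + 1)) := by
  have hcongr : Set.EqOn (fun x => γ * x * Real.exp (-(γ * x ^ 2 / 2)) * x ^ r)
      (fun x => γ * (x ^ (r + 1) * Real.exp (-(γ / 2) * x ^ 2))) (Set.Ioi 0) := fun x hx => by
    simp only [Real.rpow_add_one (ne_of_gt hx), show -(γ * x ^ 2 / 2) = -(γ / 2) * x ^ 2 by ring]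
    ring
  have hint : IntegrableOn (fun x => γ * x * Real.exp (-(γ * x ^ 2 / 2)) * x ^ r) (Set.Ioi 0) :=
    IntegrableOn.congr_fun (Integrable.const_mul (integrableOn_rpow_mul_exp_neg_mul_sq
      (half_pos hγ) (by linarith : -1 < r + 1)) γ) hcongr.symm measurableSet_Ioi
  have hgauss := integral_rpow_mul_exp_neg_mul_rpow (q := r + 1) two_pos (by linarith) (half_pos hγ)
  rw [lintegral_wallLaw hγ.le (by fun_prop), ← ofReal_integral_eq_lintegral_ofReal hint,
    setIntegral_congr_fun measurableSet_Ioi hcongr, integral_const_mul]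
  · simp only [Real.rpow_two] at hgauss
    rw [hgauss, show -(r + 1 + 1) / 2 = -r / 2 - 1 by ring, Real.rpow_sub_one (half_pos hγ).ne',
      show (r + 1 + 1) / 2 = r / 2 + 1 by ring]
    congr 1
    field_simp
  · filter_upwards [ae_restrict_mem measurableSet_Ioi] with x (hx : 0 < x)
    rw [Pi.zero_apply]
    positivity

theorem integrable_rpow_wallLaw (hr : -2 < r) : Integrable (fun x => x ^ r) (wallLaw γ) := by
  refine ⟨by fun_prop, (hasFiniteIntegral_iff_ofReal ?_).2 ?_⟩
  · filter_upwards [ae_pos_wallLaw γ] with x hx using Real.rpow_nonneg hx.le r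
  · exact lintegral_rpow_wallLaw hγ hr ▸ ENNReal.ofReal_lt_top

theorem integral_rpow_wallLaw (hr : -2 < r) :
    ∫ x, x ^ r ∂wallLaw γ = (γ / 2) ^ (-r / 2) * Real.Gamma (r / 2 + 1) := by
  have hΓ : 0 < Real.Gamma (r / 2 + 1) := Real.Gamma_pos_of_pos (by linarith)
  rw [integral_eq_lintegral_of_nonneg_ae _ (integrable_rpow_wallLaw hγ hr).aestronglyMeasurable,
    lintegral_rpow_wallLaw hγ hr, ENNReal.toReal_ofReal (by positivity)]
  filter_upwards [ae_pos_wallLaw γ] with x hx using Real.rpow_nonneg hx.le r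

/-- The mean duration of a flight that starts from a wall of inverse temperature one. -/
def meanFlightTime : ℝ := Real.sqrt (Real.pi / 2)

/-- The moment of order `3 / 2` of the duration of a flight that starts from a wall of inverse
temperature one. It bounds the error of the first-order expansion of the Laplace transform. -/
def flightTimeMoment : ℝ := (1 / 2) ^ (3 / 4 : ℝ) * Real.Gamma (1 / 4)

theorem integral_div_wallLaw (s : ℝ) :
    ∫ x, s / x ∂wallLaw γ = meanFlightTime * (Real.sqrt γ * s) := by
  have h := integral_rpow_wallLaw hγ (r := -1) (by norm_num)
  simp only [Real.rpow_neg_one] at h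
  simp_rw [div_eq_mul_inv]
  rw [integral_const_mul, h, meanFlightTime, Real.sqrt_div Real.pi_pos.le, neg_neg,
    ← Real.sqrt_eq_rpow, Real.sqrt_div hγ.le, show (-1 / 2 + 1 : ℝ) = 1 / 2 by norm_num,
    Real.Gamma_one_half_eq]
  ring

theorem integrable_div_wallLaw (s : ℝ) : Integrable (fun x => s / x) (wallLaw γ) := by
  simpa only [Real.rpow_neg_one, div_eq_mul_inv] using
    (integrable_rpow_wallLaw hγ (r := -1) (by norm_num)).const_mul s

end Moments

section Laplace

variable {γ s : ℝ} (hγ : 0 < γ) (hs : 0 ≤ s)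

include hs in
theorem div_mul_sqrt_div_eq_rpow {x : ℝ} (hx : 0 < x) :
    s / x * Real.sqrt (s / x) = s * Real.sqrt s * x ^ (-(3 / 2) : ℝ) := by
  rw [Real.sqrt_div hs, show (-(3 / 2) : ℝ) = -1 - 1 / 2 by norm_num, Real.rpow_sub hx,
    Real.rpow_neg_one, ← Real.sqrt_eq_rpow]
  ring

include hγ hs

theorem integrable_div_mul_sqrt_wallLaw :
    Integrable (fun x => s / x * Real.sqrt (s / x)) (wallLaw γ) := by
  refine ((integrable_rpow_wallLaw hγ (r := -(3 / 2)) (by norm_num)).const_mul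
    (s * Real.sqrt s)).congr ?_
  filter_upwards [ae_pos_wallLaw γ] with x hx using (div_mul_sqrt_div_eq_rpow hs hx).symm

theorem integral_div_mul_sqrt_wallLaw : ∫ x, s / x * Real.sqrt (s / x) ∂wallLaw γ =
    flightTimeMoment * (Real.sqrt γ * s * Real.sqrt (Real.sqrt γ * s)) := by
  have hcongr : ∫ x, s / x * Real.sqrt (s / x) ∂wallLaw γ =
      ∫ x, s * Real.sqrt s * x ^ (-(3 / 2) : ℝ) ∂wallLaw γ := integral_congr_ae <| by
    filter_upwards [ae_pos_wallLaw γ] with x hx using div_mul_sqrt_div_eq_rpow hs hx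
  have hpow : Real.sqrt γ * Real.sqrt (Real.sqrt γ) = γ ^ (3 / 4 : ℝ) := by
    rw [Real.sqrt_eq_rpow, Real.sqrt_eq_rpow, ← Real.rpow_mul hγ.le, ← Real.rpow_add hγ]
    norm_num
  rw [hcongr, integral_const_mul, integral_rpow_wallLaw hγ (by norm_num), flightTimeMoment,
    Real.sqrt_mul (Real.sqrt_nonneg γ), mul_mul_mul_comm (Real.sqrt γ), hpow,
    div_eq_mul_one_div γ, Real.mul_rpow hγ.le one_half_pos.le]
  norm_num
  ring

theorem integrable_exp_neg_div_wallLaw :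
    Integrable (fun x => Real.exp (-(s / x))) (wallLaw γ) := by
  have := isProbabilityMeasure_wallLaw hγ
  refine (integrable_const (1 : ℝ)).mono' (by fun_prop) ?_
  filter_upwards [ae_pos_wallLaw γ] with x hx
  rw [Real.norm_of_nonneg (Real.exp_pos _).le, Real.exp_le_one_iff, neg_nonpos]
  positivity

theorem tiltMass_wallLaw_zero_eq_ofReal :
    tiltMass (wallLaw γ) 0 s = ENNReal.ofReal (∫ x, Real.exp (-(s / x)) ∂wallLaw γ) := by
  rw [ofReal_integral_eq_lintegral_ofReal (integrable_exp_neg_div_wallLaw hγ hs)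
    (Eventually.of_forall fun x => (Real.exp_pos _).le)]
  simp [tiltMass, flightWeight]

theorem ofReal_exp_neg_le_tiltMass_wallLaw :
    ENNReal.ofReal (Real.exp (-(meanFlightTime * (Real.sqrt γ * s)))) ≤
      tiltMass (wallLaw γ) 0 s := by
  have := isProbabilityMeasure_wallLaw hγ
  rw [tiltMass_wallLaw_zero_eq_ofReal hγ hs, ← integral_div_wallLaw hγ, ← integral_neg]
  exact ENNReal.ofReal_le_ofReal (convexOn_exp.map_integral_le Real.continuous_exp.continuousOn
    isClosed_univ (Eventually.of_forall fun _ => Set.mem_univ _)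
    (integrable_div_wallLaw hγ s).neg (integrable_exp_neg_div_wallLaw hγ hs))

omit hγ hs in
theorem exp_neg_le_one_sub_add_mul_sqrt {y : ℝ} (hy : 0 ≤ y) :
    Real.exp (-y) ≤ 1 - y + y * Real.sqrt y := by
  rcases le_total y 1 with h | h
  · have hexp := (abs_le.1 (Real.abs_exp_sub_one_sub_id_le (x := -y)
      (by rwa [abs_neg, abs_of_nonneg hy]))).2
    have hsqrt : y ≤ Real.sqrt y := Real.le_sqrt_of_sq_le (by nlinarith)
    nlinarith
  · have hexp : Real.exp (-y) ≤ 1 := Real.exp_le_one_iff.2 (neg_nonpos.2 hy)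
    have hsqrt : 1 ≤ Real.sqrt y := Real.one_le_sqrt.2 h
    nlinarith

/-- A lower bound, of the first order in `s`, for the negative logarithm of the Laplace transform at
`s` of the duration of a flight that starts from a wall of inverse temperature `γ`. -/
def flightDecay (γ s : ℝ) : ℝ :=
  Real.sqrt γ * s * (meanFlightTime - flightTimeMoment * Real.sqrt (Real.sqrt γ * s))

theorem tiltMass_wallLaw_le_ofReal_exp_neg :
    tiltMass (wallLaw γ) 0 s ≤ ENNReal.ofReal (Real.exp (-flightDecay γ s)) := by
  have := isProbabilityMeasure_wallLaw hγ
  have hfst := integrable_div_wallLaw hγ s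
  have hsnd := integrable_div_mul_sqrt_wallLaw hγ hs
  have hlin : Integrable (fun x => 1 - s / x) (wallLaw γ) := (integrable_const 1).sub hfst
  rw [tiltMass_wallLaw_zero_eq_ofReal hγ hs]
  refine ENNReal.ofReal_le_ofReal ?_
  calc ∫ x, Real.exp (-(s / x)) ∂wallLaw γ
      ≤ ∫ x, (1 - s / x + s / x * Real.sqrt (s / x)) ∂wallLaw γ := by
        refine integral_mono_ae (integrable_exp_neg_div_wallLaw hγ hs) (hlin.add hsnd) ?_
        filter_upwards [ae_pos_wallLaw γ] with x hx
        exact exp_neg_le_one_sub_add_mul_sqrt (div_nonneg hs hx.le)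
    _ = -flightDecay γ s + 1 := by
        rw [integral_add hlin hsnd, integral_sub (integrable_const 1) hfst,
          integral_div_wallLaw hγ, integral_div_mul_sqrt_wallLaw hγ hs, flightDecay]
        simp only [integral_const, probReal_univ, smul_eq_mul]
        ring
    _ ≤ Real.exp (-flightDecay γ s) := Real.add_one_le_exp _

end Laplace

/-! ### Bounds for the growth rate -/

/-- The mean duration of two successive flights that start from walls of inverse temperatures `βL`
and `βR`. -/
def meanCycleTime (βL βR : ℝ) : ℝ := meanFlightTime * (Real.sqrt βL + Real.sqrt βR)

theorem meanCycleTime_pos {βL βR : ℝ} (hL : 0 < βL) (hR : 0 < βR) : 0 < meanCycleTime βL βR := by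
  unfold meanCycleTime meanFlightTime
  positivity

section GrowthRateBounds

variable {βL βR : ℝ} (hL : 0 < βL) (hR : 0 < βR) {l s : ℝ}

include hL hR

theorem growthRate_nonneg (l : ℝ) : 0 ≤ growthRate βL βR l :=
  le_iInf₂ fun _ hs => EReal.coe_nonneg.2 (nonneg_of_cycleMass_lt_one hL hR hs)

theorem cycleMass_eq_mul (hl : l < βL) (hl' : -l < βR) (s : ℝ) : cycleMass βL βR l s =
    ENNReal.ofReal ((βL - l) * (βR + l) / (βL * βR))⁻¹ *
      (tiltMass (wallLaw (βL - l)) 0 s * tiltMass (wallLaw (βR + l)) 0 s) := by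
  have : 0 < βL - l := sub_pos.2 hl
  rw [cycleMass, tiltMass_wallLaw_eq_mul hL.le hl, tiltMass_wallLaw_eq_mul hR.le hl',
    sub_neg_eq_add, mul_mul_mul_comm, ← ENNReal.ofReal_mul (by positivity), inv_div,
    div_mul_div_comm]

theorem le_growthRate (h : l < βL → -l < βR →
      meanCycleTime (βL - l) (βR + l) * s ≤ 1 - (βL - l) * (βR + l) / (βL * βR)) :
    (s : EReal) ≤ growthRate βL βR l := by
  refine le_iInf₂ fun s' hs' => EReal.coe_le_coe_iff.2 ?_
  have hs0 := nonneg_of_cycleMass_lt_one hL hR hs'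
  obtain ⟨hfinL, hfinR⟩ := tiltMass_ne_top_of_cycleMass_ne_top hL hR hs'.ne_top
  have hl : l < βL := not_le.1 fun hle => hfinL (tiltMass_wallLaw_eq_top_of_le hL hle s')
  have hl' : -l < βR := not_le.1 fun hle => hfinR (tiltMass_wallLaw_eq_top_of_le hR hle s')
  have hγL : 0 < βL - l := sub_pos.2 hl
  have hγR : 0 < βR + l := by linarith
  set r := (βL - l) * (βR + l) / (βL * βR)
  set D := meanCycleTime (βL - l) (βR + l) with hD
  have hDpos : 0 < D := meanCycleTime_pos hγL hγR
  have hr : 0 < r := by unfold r; positivity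
  have hmass : ENNReal.ofReal (r⁻¹ * Real.exp (-(D * s'))) < 1 := by
    refine lt_of_le_of_lt ?_ hs'
    rw [cycleMass_eq_mul hL hR hl hl', ENNReal.ofReal_mul (by positivity),
      show -(D * s') = -(meanFlightTime * (Real.sqrt (βL - l) * s')) +
        -(meanFlightTime * (Real.sqrt (βR + l) * s')) by rw [hD, meanCycleTime]; ring,
      Real.exp_add, ENNReal.ofReal_mul (Real.exp_pos _).le]
    gcongr
    exacts [ofReal_exp_neg_le_tiltMass_wallLaw hγL hs0, ofReal_exp_neg_le_tiltMass_wallLaw hγR hs0]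
  rw [ENNReal.ofReal_lt_one, inv_mul_lt_one₀ hr] at hmass
  have htangent := Real.add_one_le_exp (-(D * s'))
  exact le_of_mul_le_mul_left ((h hl hl').trans (by linarith)) hDpos

theorem growthRate_le (hl : l < βL) (hl' : -l < βR) (hs : 0 ≤ s)
    (h : ((βL - l) * (βR + l) / (βL * βR))⁻¹ - 1 <
      flightDecay (βL - l) s + flightDecay (βR + l) s) :
    growthRate βL βR l ≤ s := by
  have hγL : 0 < βL - l := sub_pos.2 hl
  have hγR : 0 < βR + l := by linarith
  refine iInf₂_le s ?_
  set r := (βL - l) * (βR + l) / (βL * βR)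
  have : 0 < r := by unfold r; positivity
  set X := flightDecay (βL - l) s + flightDecay (βR + l) s with hX
  calc cycleMass βL βR l s
      ≤ ENNReal.ofReal r⁻¹ * (ENNReal.ofReal (Real.exp (-flightDecay (βL - l) s)) *
          ENNReal.ofReal (Real.exp (-flightDecay (βR + l) s))) := by
        rw [cycleMass_eq_mul hL hR hl hl']
        gcongr
        exacts [tiltMass_wallLaw_le_ofReal_exp_neg hγL hs,
          tiltMass_wallLaw_le_ofReal_exp_neg hγR hs]
    _ = ENNReal.ofReal (r⁻¹ / Real.exp X) := by
        rw [← ENNReal.ofReal_mul (Real.exp_pos _).le, ← Real.exp_add, ← neg_add, ← hX,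
          ← ENNReal.ofReal_mul (by positivity), Real.exp_neg, div_eq_mul_inv]
    _ < 1 := by
        rw [ENNReal.ofReal_lt_one, div_lt_one (Real.exp_pos _)]
        linarith [Real.add_one_le_exp X]

end GrowthRateBounds

/-! ### The scaling limit of the growth rate -/

theorem kappa_pos {T : ℝ} (hT : 0 < T) : 0 < kappa T :=
  Real.sqrt_pos.2 (div_pos hT (by positivity))

theorem continuous_kappa : Continuous kappa := by
  unfold kappa
  fun_prop

theorem monotone_kappa : Monotone kappa := fun _ _ h =>
  Real.sqrt_le_sqrt (div_le_div_of_nonneg_right h (by positivity))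

theorem meanCycleTime_mul_kappa {T : ℝ} (hT : 0 < T) :
    meanCycleTime (1 / T) (1 / T) * kappa T = 1 := by
  rw [meanCycleTime, meanFlightTime, kappa, ← two_mul, mul_left_comm, mul_assoc, mul_assoc,
    ← Real.sqrt_mul (by positivity), ← Real.sqrt_mul (by positivity),
    show Real.pi / 2 * (1 / T * (T / (2 * Real.pi))) = (1 / 2) ^ 2 by field_simp,
    Real.sqrt_sq one_half_pos.le, mul_one_div_cancel two_ne_zero]

theorem calH_eq_kappa_mul_max {T : ℝ} (hT : 0 < T) (l τ : ℝ) :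
    calH l τ T = kappa T * max 0 (l * τ + l ^ 2 * T ^ 2) := by
  have hfactor : τ ≠ 0 →
      l * τ * (l * τ + τ ^ 2 / T ^ 2) = τ ^ 2 / T ^ 2 * (l * τ + l ^ 2 * T ^ 2) := fun _ => by
    field_simp
    ring
  unfold calH
  split_ifs with hτ hpos hmid
  · rw [hτ, mul_zero, zero_add, max_eq_right (by positivity)]
    ring
  · rw [max_eq_right (by positivity)]
    ring
  · have hle : l * τ * (l * τ + τ ^ 2 / T ^ 2) ≤ 0 :=
      mul_nonpos_of_nonpos_of_nonneg (not_lt.1 hpos) (neg_le_iff_add_nonneg.1 hmid)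
    rw [max_eq_left (nonpos_of_mul_nonpos_right (hfactor hτ ▸ hle) (by positivity)), mul_zero]
  · have hge : 0 ≤ l * τ * (l * τ + τ ^ 2 / T ^ 2) :=
      mul_nonneg_of_nonpos_of_nonpos (not_lt.1 hpos) (by linarith)
    rw [max_eq_right (nonneg_of_mul_nonneg_right (hfactor hτ ▸ hge) (by positivity))]
    field_simp
    ring

theorem calH_nonneg {T : ℝ} (hT : 0 < T) (l τ : ℝ) : 0 ≤ calH l τ T :=
  calH_eq_kappa_mul_max hT l τ ▸ mul_nonneg (kappa_pos hT).le (le_max_left _ _)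

/-- The tilted inverse temperature `β_L - ε l` of the left wall, for `β_L = 1 / (T + ε τ / 2)`. -/
def tiltedBetaL (ε l τ T : ℝ) : ℝ := 1 / (T + ε * τ / 2) - ε * l

/-- The tilted inverse temperature `β_R + ε l` of the right wall, for `β_R = 1 / (T - ε τ / 2)`. -/
def tiltedBetaR (ε l τ T : ℝ) : ℝ := 1 / (T - ε * τ / 2) + ε * l

/-- The quantity `q` such that `1 - ε ^ 2 * q` is the ratio of the product of the tilted inverse
temperatures to the product of the inverse temperatures. -/
def scaledExcess (ε l τ T : ℝ) : ℝ := l * τ + l ^ 2 * (T ^ 2 - ε ^ 2 * τ ^ 2 / 4)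

/-- The growth rate at the scaled parameters, divided by `ε ^ 2`. -/
def rescaledGrowthRate (ε l τ T : ℝ) : EReal :=
  ((1 / ε ^ 2 : ℝ) : EReal) * growthRate (1 / (T + ε * τ / 2)) (1 / (T - ε * τ / 2)) (ε * l)

section Rescaled

variable {ε l τ T σ : ℝ}

theorem temperatures_pos (hετ : |ε * τ| < T) : 0 < T + ε * τ / 2 ∧ 0 < T - ε * τ / 2 := by
  obtain ⟨hneg, hpos⟩ := abs_lt.1 hετ
  constructor <;> linarith

theorem tiltedBeta_mul_div_eq (hετ : |ε * τ| < T) :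
    tiltedBetaL ε l τ T * tiltedBetaR ε l τ T / (1 / (T + ε * τ / 2) * (1 / (T - ε * τ / 2))) =
      1 - ε ^ 2 * scaledExcess ε l τ T := by
  obtain ⟨hL, hR⟩ := temperatures_pos hετ
  have hexcess : ε ^ 2 * scaledExcess ε l τ T =
      ε * l * ((T + ε * τ / 2) - (T - ε * τ / 2)) +
        (ε * l) ^ 2 * ((T + ε * τ / 2) * (T - ε * τ / 2)) := by
    rw [scaledExcess]
    ring
  rw [hexcess, tiltedBetaL, tiltedBetaR]
  generalize T + ε * τ / 2 = TL at *
  generalize T - ε * τ / 2 = TR at *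
  field_simp
  ring

theorem one_div_sq_mul_coe (hε : 0 < ε) (x : ℝ) :
    ((1 / ε ^ 2 : ℝ) : EReal) * ((ε ^ 2 * x : ℝ) : EReal) = x := by
  rw [← EReal.coe_mul, one_div, inv_mul_cancel_left₀ (by positivity)]

theorem one_div_sq_mul_calF (q₀ : ℝ) {p₀ : ℝ} (hp₀ : p₀ ≠ 0) (hετ : |ε * τ| < T) :
    ((1 / ε ^ 2 : ℝ) : EReal) * calF q₀ p₀ (ε * l) (ε * τ) T = rescaledGrowthRate ε l τ T := by
  obtain ⟨hL, hR⟩ := temperatures_pos hετ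
  rw [calF, cumulantGF_eq_growthRate (one_div_pos.2 hL) (one_div_pos.2 hR) q₀ hp₀,
    rescaledGrowthRate]

theorem rescaledGrowthRate_nonneg (hετ : |ε * τ| < T) : 0 ≤ rescaledGrowthRate ε l τ T := by
  obtain ⟨hL, hR⟩ := temperatures_pos hετ
  exact mul_nonneg (EReal.coe_nonneg.2 (by positivity))
    (growthRate_nonneg (one_div_pos.2 hL) (one_div_pos.2 hR) _)

theorem le_rescaledGrowthRate (hε : 0 < ε) (hετ : |ε * τ| < T)
    (h : 0 < tiltedBetaL ε l τ T → 0 < tiltedBetaR ε l τ T →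
      meanCycleTime (tiltedBetaL ε l τ T) (tiltedBetaR ε l τ T) * σ ≤ scaledExcess ε l τ T) :
    (σ : EReal) ≤ rescaledGrowthRate ε l τ T := by
  obtain ⟨hL, hR⟩ := temperatures_pos hετ
  rw [← one_div_sq_mul_coe hε]
  refine mul_le_mul_of_nonneg_left (le_growthRate (one_div_pos.2 hL) (one_div_pos.2 hR)
    fun hl hl' => ?_) (EReal.coe_nonneg.2 (by positivity))
  change meanCycleTime (tiltedBetaL ε l τ T) (tiltedBetaR ε l τ T) * _ ≤
    1 - tiltedBetaL ε l τ T * tiltedBetaR ε l τ T / _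
  rw [tiltedBeta_mul_div_eq hετ, sub_sub_cancel, mul_left_comm]
  exact mul_le_mul_of_nonneg_left (h (sub_pos.2 hl) (neg_lt_iff_pos_add.1 hl')) (sq_nonneg ε)

theorem max_zero_div_le_rescaledGrowthRate (hε : 0 < ε) (hετ : |ε * τ| < T) :
    ((max 0 (scaledExcess ε l τ T /
      meanCycleTime (tiltedBetaL ε l τ T) (tiltedBetaR ε l τ T)) : ℝ) : EReal) ≤
      rescaledGrowthRate ε l τ T := by
  rw [EReal.coe_strictMono.monotone.map_max]
  exact max_le (rescaledGrowthRate_nonneg hετ) (le_rescaledGrowthRate hε hετ fun hL hR =>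
    (mul_div_cancel₀ _ (meanCycleTime_pos hL hR).ne').le)

/-- The value of `flightDecay γ (ε ^ 2 * σ)` divided by `ε ^ 2`, which is regular at `ε = 0`. -/
def rescaledFlightDecay (ε γ σ : ℝ) : ℝ :=
  Real.sqrt γ * σ * (meanFlightTime - flightTimeMoment * (ε * Real.sqrt (Real.sqrt γ * σ)))

theorem flightDecay_sq_mul (hε : 0 ≤ ε) (γ σ : ℝ) :
    flightDecay γ (ε ^ 2 * σ) = ε ^ 2 * rescaledFlightDecay ε γ σ := by
  rw [flightDecay, rescaledFlightDecay, mul_left_comm (Real.sqrt γ), Real.sqrt_mul (sq_nonneg ε),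
    Real.sqrt_sq hε]
  ring

theorem rescaledGrowthRate_le (hε : 0 < ε) (hετ : |ε * τ| < T) (hL : 0 < tiltedBetaL ε l τ T)
    (hR : 0 < tiltedBetaR ε l τ T) (hσ : 0 ≤ σ)
    (h : scaledExcess ε l τ T < (rescaledFlightDecay ε (tiltedBetaL ε l τ T) σ +
      rescaledFlightDecay ε (tiltedBetaR ε l τ T) σ) * (1 - ε ^ 2 * scaledExcess ε l τ T)) :
    rescaledGrowthRate ε l τ T ≤ σ := by
  obtain ⟨hTL, hTR⟩ := temperatures_pos hετ
  have hratio : 0 < 1 - ε ^ 2 * scaledExcess ε l τ T := by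
    rw [← tiltedBeta_mul_div_eq hετ]
    positivity
  rw [← one_div_sq_mul_coe hε σ]
  refine mul_le_mul_of_nonneg_left (growthRate_le (one_div_pos.2 hTL) (one_div_pos.2 hTR)
    (sub_pos.1 hL) (neg_lt_iff_pos_add.2 hR) (by positivity) ?_)
    (EReal.coe_nonneg.2 (by positivity))
  change (tiltedBetaL ε l τ T * tiltedBetaR ε l τ T / _)⁻¹ - 1 <
    flightDecay (tiltedBetaL ε l τ T) _ + flightDecay (tiltedBetaR ε l τ T) _
  rw [tiltedBeta_mul_div_eq hετ, flightDecay_sq_mul hε.le, flightDecay_sq_mul hε.le, ← mul_add,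
    sub_lt_iff_lt_add, inv_lt_iff_one_lt_mul₀ hratio]
  linarith [mul_lt_mul_of_pos_left h (pow_pos hε 2)]

end Rescaled

theorem tiltedBeta_zero (l τ T : ℝ) :
    tiltedBetaL 0 l τ T = 1 / T ∧ tiltedBetaR 0 l τ T = 1 / T := by
  simp [tiltedBetaL, tiltedBetaR]

theorem continuous_scaledExcess : Continuous
    fun z : ℝ × ℝ × ℝ × ℝ => scaledExcess z.1 z.2.1 z.2.2.1 z.2.2.2 := by
  unfold scaledExcess
  fun_prop

theorem rescaledFlightDecay_zero_add (βL βR σ : ℝ) : rescaledFlightDecay 0 βL σ +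
    rescaledFlightDecay 0 βR σ = meanCycleTime βL βR * σ := by
  rw [rescaledFlightDecay, rescaledFlightDecay, meanCycleTime]
  ring

theorem continuousAt_rescaledFlightDecay {X : Type*} [TopologicalSpace X] {ε γ σ : X → ℝ} {x : X}
    (hε : ContinuousAt ε x) (hγ : ContinuousAt γ x) (hσ : ContinuousAt σ x) :
    ContinuousAt (fun y => rescaledFlightDecay (ε y) (γ y) (σ y)) x := by
  unfold rescaledFlightDecay
  fun_prop

section Continuity

variable {T : ℝ} (hT : 0 < T) (l τ : ℝ)

include hT

theorem continuousAt_tiltedBetaL : ContinuousAt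
    (fun z : ℝ × ℝ × ℝ × ℝ => tiltedBetaL z.1 z.2.1 z.2.2.1 z.2.2.2) (0, l, τ, T) := by
  unfold tiltedBetaL
  exact (continuousAt_const.div (by fun_prop) (by simpa using hT.ne')).sub (by fun_prop)

theorem continuousAt_tiltedBetaR : ContinuousAt
    (fun z : ℝ × ℝ × ℝ × ℝ => tiltedBetaR z.1 z.2.1 z.2.2.1 z.2.2.2) (0, l, τ, T) := by
  unfold tiltedBetaR
  exact (continuousAt_const.div (by fun_prop) (by simpa using hT.ne')).add (by fun_prop)

theorem continuousAt_calH : ContinuousAt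
    (fun z : ℝ × ℝ × ℝ × ℝ => calH z.2.1 z.2.2.1 z.2.2.2) (0, l, τ, T) := by
  have hcont : Continuous fun z : ℝ × ℝ × ℝ × ℝ =>
      kappa z.2.2.2 * max 0 (z.2.1 * z.2.2.1 + z.2.1 ^ 2 * z.2.2.2 ^ 2) :=
    (continuous_kappa.comp (by fun_prop)).mul (by fun_prop)
  have hpos : ContinuousAt (fun z : ℝ × ℝ × ℝ × ℝ => z.2.2.2) (0, l, τ, T) := by fun_prop
  refine hcont.continuousAt.congr ?_
  filter_upwards [hpos.eventually_const_lt hT] with z hz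
    using (calH_eq_kappa_mul_max hz z.2.1 z.2.2.1).symm

theorem meanCycleTime_mul_calH :
    meanCycleTime (1 / T) (1 / T) * calH l τ T = max 0 (scaledExcess 0 l τ T) := by
  rw [calH_eq_kappa_mul_max hT, ← mul_assoc, meanCycleTime_mul_kappa hT, one_mul, scaledExcess]
  simp

theorem continuousAt_meanCycleTime_tiltedBeta : ContinuousAt (fun z : ℝ × ℝ × ℝ × ℝ =>
    meanCycleTime (tiltedBetaL z.1 z.2.1 z.2.2.1 z.2.2.2) (tiltedBetaR z.1 z.2.1 z.2.2.1 z.2.2.2))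
    (0, l, τ, T) :=
  continuousAt_const.mul
    ((continuousAt_tiltedBetaL hT l τ).sqrt.add (continuousAt_tiltedBetaR hT l τ).sqrt)

theorem eventually_abs_mul_lt :
    ∀ᶠ z : ℝ × ℝ × ℝ × ℝ in 𝓝 (0, l, τ, T), |z.1 * z.2.2.1| < z.2.2.2 := by
  refine ContinuousAt.eventually_lt (by fun_prop) (by fun_prop) ?_
  simpa using hT

theorem eventually_lt_rescaledGrowthRate {δ : ℝ} (hδ : 0 < δ) :
    ∀ᶠ z : ℝ × ℝ × ℝ × ℝ in 𝓝 (0, l, τ, T), 0 < z.1 →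
      ((calH z.2.1 z.2.2.1 z.2.2.2 - δ : ℝ) : EReal) <
        rescaledGrowthRate z.1 z.2.1 z.2.2.1 z.2.2.2 := by
  obtain ⟨hβL, hβR⟩ := tiltedBeta_zero l τ T
  have hD : 0 < meanCycleTime (1 / T) (1 / T) :=
    meanCycleTime_pos (one_div_pos.2 hT) (one_div_pos.2 hT)
  have hlimit : max 0 (scaledExcess 0 l τ T / meanCycleTime (1 / T) (1 / T)) = calH l τ T := by
    rw [eq_comm, eq_div_of_mul_eq hD.ne' ((mul_comm _ _).trans (meanCycleTime_mul_calH hT l τ)),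
      ← max_div_div_right hD.le, zero_div]
  have hbound : ∀ᶠ z : ℝ × ℝ × ℝ × ℝ in 𝓝 (0, l, τ, T), calH z.2.1 z.2.2.1 z.2.2.2 - δ <
      max 0 (scaledExcess z.1 z.2.1 z.2.2.1 z.2.2.2 / meanCycleTime
        (tiltedBetaL z.1 z.2.1 z.2.2.1 z.2.2.2) (tiltedBetaR z.1 z.2.1 z.2.2.1 z.2.2.2)) := by
    refine ((continuousAt_calH hT l τ).sub continuousAt_const).eventually_lt
      (continuousAt_const.sup (continuous_scaledExcess.continuousAt.div
        (continuousAt_meanCycleTime_tiltedBeta hT l τ) ?_)) ?_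
    · simpa only [hβL, hβR] using hD.ne'
    · simp only [hβL, hβR, hlimit]
      exact sub_lt_self _ hδ
  filter_upwards [hbound, eventually_abs_mul_lt hT l τ] with z hz hετ hε
  exact (EReal.coe_lt_coe_iff.2 hz).trans_le (max_zero_div_le_rescaledGrowthRate hε hετ)

theorem eventually_rescaledGrowthRate_lt {δ : ℝ} (hδ : 0 < δ) :
    ∀ᶠ z : ℝ × ℝ × ℝ × ℝ in 𝓝 (0, l, τ, T), 0 < z.1 →
      rescaledGrowthRate z.1 z.2.1 z.2.2.1 z.2.2.2 <
        ((calH z.2.1 z.2.2.1 z.2.2.2 + δ : ℝ) : EReal) := by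
  obtain ⟨hβL, hβR⟩ := tiltedBeta_zero l τ T
  have hβ : 0 < 1 / T := one_div_pos.2 hT
  have hL := continuousAt_tiltedBetaL hT l τ
  have hR := continuousAt_tiltedBetaR hT l τ
  have hq := (continuous_scaledExcess.continuousAt (x := (0, l, τ, T)))
  have hσ : ContinuousAt (fun z : ℝ × ℝ × ℝ × ℝ => calH z.2.1 z.2.2.1 z.2.2.2 + δ / 2)
      (0, l, τ, T) := (continuousAt_calH hT l τ).add continuousAt_const
  have hcriterion : ∀ᶠ z : ℝ × ℝ × ℝ × ℝ in 𝓝 (0, l, τ, T),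
      scaledExcess z.1 z.2.1 z.2.2.1 z.2.2.2 <
        (rescaledFlightDecay z.1 (tiltedBetaL z.1 z.2.1 z.2.2.1 z.2.2.2)
            (calH z.2.1 z.2.2.1 z.2.2.2 + δ / 2) +
          rescaledFlightDecay z.1 (tiltedBetaR z.1 z.2.1 z.2.2.1 z.2.2.2)
            (calH z.2.1 z.2.2.1 z.2.2.2 + δ / 2)) *
          (1 - z.1 ^ 2 * scaledExcess z.1 z.2.1 z.2.2.1 z.2.2.2) := by
    refine hq.eventually_lt (((continuousAt_rescaledFlightDecay continuousAt_fst hL hσ).add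
      (continuousAt_rescaledFlightDecay continuousAt_fst hR hσ)).mul
      (continuousAt_const.sub ((continuousAt_fst.pow 2).mul hq))) ?_
    simp only [hβL, hβR, rescaledFlightDecay_zero_add, mul_add, meanCycleTime_mul_calH hT,
      zero_pow two_ne_zero, zero_mul, sub_zero, mul_one]
    exact lt_add_of_le_of_pos (le_max_right _ _) (mul_pos (meanCycleTime_pos hβ hβ) (half_pos hδ))
  filter_upwards [hcriterion, eventually_abs_mul_lt hT l τ,
    hL.eventually_const_lt (hβL.symm ▸ hβ), hR.eventually_const_lt (hβR.symm ▸ hβ)]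
    with z hz hετ hLz hRz hε
  have hHz : 0 ≤ calH z.2.1 z.2.2.1 z.2.2.2 := calH_nonneg ((abs_nonneg _).trans_lt hετ) _ _
  exact (rescaledGrowthRate_le hε hετ hLz hRz (by positivity) hz).trans_lt
    (EReal.coe_lt_coe_iff.2 (by linarith))

end Continuity

theorem eventually_forall_rescaledGrowthRate_mem_Ioo {K : Set (ℝ × ℝ × ℝ)} (hK : IsCompact K)
    (hpos : ∀ x ∈ K, 0 < x.2.2) {δ : ℝ} (hδ : 0 < δ) :
    ∀ᶠ ε : ℝ in 𝓝[>] 0, ∀ x ∈ K, rescaledGrowthRate ε x.1 x.2.1 x.2.2 ∈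
      Set.Ioo ((calH x.1 x.2.1 x.2.2 - δ : ℝ) : EReal)
        ((calH x.1 x.2.1 x.2.2 + δ : ℝ) : EReal) := by
  have hnear : ∀ᶠ ε : ℝ in 𝓝 0, ∀ x ∈ K, 0 < ε → rescaledGrowthRate ε x.1 x.2.1 x.2.2 ∈ Set.Ioo
      ((calH x.1 x.2.1 x.2.2 - δ : ℝ) : EReal) ((calH x.1 x.2.1 x.2.2 + δ : ℝ) : EReal) := by
    refine hK.eventually_forall_of_forall_eventually fun ⟨l, τ, T⟩ hx => ?_
    filter_upwards [eventually_lt_rescaledGrowthRate (hpos _ hx) l τ hδ,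
      eventually_rescaledGrowthRate_lt (hpos _ hx) l τ hδ] with z hlower hupper hε
      using ⟨hlower hε, hupper hε⟩
  filter_upwards [nhdsWithin_le_nhds hnear, self_mem_nhdsWithin] with ε hε hε0 x hx
    using hε x hx hε0

section Coercivity

variable {ε l τ T T₀ B : ℝ}

theorem meanCycleTime_le {βL βR : ℝ} (hL : 0 ≤ βL) (hR : 0 ≤ βR) :
    meanCycleTime βL βR ≤ meanFlightTime * Real.sqrt (2 * (βL + βR)) := by
  refine mul_le_mul_of_nonneg_left (Real.le_sqrt_of_sq_le (add_sq_le.trans_eq ?_))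
    (Real.sqrt_nonneg _)
  rw [Real.sq_sqrt hL, Real.sq_sqrt hR]

theorem three_quarters_mul_sq_le (hετ : |ε * τ| < T) :
    3 / 4 * T ^ 2 ≤ T ^ 2 - ε ^ 2 * τ ^ 2 / 4 := by
  have hsq := sq_le_sq' (abs_le.1 hετ.le).1 (abs_le.1 hετ.le).2
  rw [mul_pow] at hsq
  linarith

theorem tiltedBeta_add_le (hT₀ : 0 < T₀) (hT : T₀ ≤ T) (hετ : |ε * τ| < T) :
    tiltedBetaL ε l τ T + tiltedBetaR ε l τ T ≤ 8 / (3 * T₀) := by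
  obtain ⟨hL, hR⟩ := temperatures_pos hετ
  have hTpos : 0 < T := hT₀.trans_le hT
  calc tiltedBetaL ε l τ T + tiltedBetaR ε l τ T
      = 2 * T / (T ^ 2 - ε ^ 2 * τ ^ 2 / 4) := by
        rw [tiltedBetaL, tiltedBetaR, sub_add_add_cancel, div_add_div _ _ hL.ne' hR.ne']
        congr 1 <;> ring
    _ ≤ 2 * T / (3 / 4 * T ^ 2) := by
        gcongr
        exact three_quarters_mul_sq_le hετ
    _ = 8 / (3 * T) := by
        field_simp
        norm_num
    _ ≤ 8 / (3 * T₀) := by gcongr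

theorem abs_mul_sub_le_scaledExcess (hT₀ : 0 < T₀) (hT : T₀ ≤ T) (hετ : |ε * τ| < T)
    (hτ : |τ| ≤ B) : |l| * (3 / 4 * T₀ ^ 2 * |l| - B) ≤ scaledExcess ε l τ T := by
  have hlinear : -(|l| * B) ≤ l * τ :=
    (neg_le_neg (mul_le_mul_of_nonneg_left hτ (abs_nonneg l))).trans (abs_mul l τ ▸ neg_abs_le _)
  have hquadratic : l ^ 2 * (3 / 4 * T₀ ^ 2) ≤ l ^ 2 * (T ^ 2 - ε ^ 2 * τ ^ 2 / 4) := by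
    refine mul_le_mul_of_nonneg_left (le_trans ?_ (three_quarters_mul_sq_le hετ)) (sq_nonneg l)
    gcongr
  calc |l| * (3 / 4 * T₀ ^ 2 * |l| - B) = -(|l| * B) + |l| ^ 2 * (3 / 4 * T₀ ^ 2) := by ring
    _ ≤ scaledExcess ε l τ T := sq_abs l ▸ add_le_add hlinear hquadratic

theorem exists_forall_abs_mul_le_rescaledGrowthRate (hT₀ : 0 < T₀) (B : ℝ) :
    ∃ R : ℝ, ∀ ε l τ T : ℝ, 0 < ε → |ε * τ| < T → |τ| ≤ B → T₀ ≤ T → R ≤ |l| →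
      ((|l| * B : ℝ) : EReal) ≤ rescaledGrowthRate ε l τ T := by
  set D := meanFlightTime * Real.sqrt (2 * (8 / (3 * T₀)))
  refine ⟨(B + D * B) / (3 / 4 * T₀ ^ 2), fun ε l τ T hε hετ hτ hT hl => ?_⟩
  refine le_rescaledGrowthRate hε hετ fun hL hR => ?_
  have hB : 0 ≤ B := (abs_nonneg τ).trans hτ
  have hcycle : meanCycleTime (tiltedBetaL ε l τ T) (tiltedBetaR ε l τ T) ≤ D := by
    refine (meanCycleTime_le hL.le hR.le).trans
      (mul_le_mul_of_nonneg_left (Real.sqrt_le_sqrt ?_) (Real.sqrt_nonneg _))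
    linarith [tiltedBeta_add_le (l := l) hT₀ hT hετ]
  rw [div_le_iff₀' (by positivity)] at hl
  calc meanCycleTime (tiltedBetaL ε l τ T) (tiltedBetaR ε l τ T) * (|l| * B)
      ≤ D * (|l| * B) := by gcongr
    _ = |l| * (D * B) := mul_left_comm _ _ _
    _ ≤ |l| * (3 / 4 * T₀ ^ 2 * |l| - B) :=
        mul_le_mul_of_nonneg_left (by linarith) (abs_nonneg l)
    _ ≤ scaledExcess ε l τ T := abs_mul_sub_le_scaledExcess hT₀ hT hετ hτ

end Coercivity

/-! ### The Legendre transform -/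

theorem ne_zero_and_abs_mul_lt {c j τ : ℝ} (h : |j| < c * |τ|) :
    τ ≠ 0 ∧ |j * τ| < c * τ ^ 2 := by
  have hτ : τ ≠ 0 := by
    rintro rfl
    simp only [abs_zero, mul_zero] at h
    exact (abs_nonneg j).not_gt h
  refine ⟨hτ, ?_⟩
  rw [abs_mul, ← sq_abs τ, sq, ← mul_assoc]
  exact mul_lt_mul_of_pos_right h (abs_pos.2 hτ)

section LegendreTransform

variable {T j τ : ℝ}

theorem calG_of_abs_lt (h : |j| < kappa T * |τ|) : calG j τ T = max 0 (-(j * τ) / T ^ 2) := by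
  obtain ⟨hτ, hprod⟩ := ne_zero_and_abs_mul_lt h
  obtain ⟨hge, hle⟩ := abs_lt.1 hprod
  rw [calG, if_neg hτ, if_neg hle.le.not_gt, if_pos hge.le]
  split_ifs with hnonneg
  · rw [max_eq_left (div_nonpos_of_nonpos_of_nonneg (neg_nonpos.2 hnonneg) (sq_nonneg T))]
  · rw [max_eq_right (div_nonneg (by linarith) (sq_nonneg T))]

variable (hT : 0 < T)

include hT

theorem calG_of_mul_abs_le (h : kappa T * |τ| ≤ |j|) :
    calG j τ T = (j - kappa T * τ) ^ 2 / (4 * kappa T * T ^ 2) := by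
  have hκ := kappa_pos hT
  have hprod : kappa T * τ ^ 2 ≤ |j * τ| := by
    rw [abs_mul, ← sq_abs τ]
    nlinarith [mul_le_mul_of_nonneg_right h (abs_nonneg τ)]
  unfold calG
  split_ifs with hτ hgt hnonneg hge
  · rw [hτ, mul_zero, sub_zero]
  · rfl
  · rw [abs_of_nonneg hnonneg] at hprod
    have hj : j = kappa T * τ := mul_right_cancel₀ hτ (by linarith)
    rw [hj]
    simp
  · rw [abs_of_neg (not_le.1 hnonneg)] at hprod
    have hj : j = -(kappa T * τ) := mul_right_cancel₀ hτ (by linarith)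
    rw [hj]
    field_simp
    ring
  · rfl

theorem calH_neg_div_sq_sub (l τ : ℝ) : calH (-(τ / T ^ 2) - l) τ T = calH l τ T := by
  rw [calH_eq_kappa_mul_max hT, calH_eq_kappa_mul_max hT]
  congr 2
  field_simp
  ring

theorem mul_mul_le_calH {a : ℝ} (ha : 0 ≤ a) (ha' : a ≤ 1) (l τ : ℝ) :
    a * (kappa T * (l * τ + l ^ 2 * T ^ 2)) ≤ calH l τ T := by
  have hκ := kappa_pos hT
  rw [calH_eq_kappa_mul_max hT, mul_left_comm]
  refine mul_le_mul_of_nonneg_left ?_ hκ.le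
  exact (mul_le_mul_of_nonneg_left (le_max_right 0 _) ha).trans
    (mul_le_of_le_one_left (le_max_left 0 _) ha')

theorem mul_sub_calH_le_sq_div (l : ℝ) :
    l * j - calH l τ T ≤ (j - kappa T * τ) ^ 2 / (4 * kappa T * T ^ 2) := by
  have hκ := kappa_pos hT
  have hle := mul_mul_le_calH hT zero_le_one le_rfl l τ
  rw [le_div_iff₀ (by positivity)]
  have : 0 ≤ 4 * kappa T * T ^ 2 := by positivity
  calc (l * j - calH l τ T) * (4 * kappa T * T ^ 2)
      ≤ (l * j - 1 * (kappa T * (l * τ + l ^ 2 * T ^ 2))) * (4 * kappa T * T ^ 2) := by gcongr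
    _ = (j - kappa T * τ) ^ 2 - (j - kappa T * τ - 2 * kappa T * l * T ^ 2) ^ 2 := by ring
    _ ≤ (j - kappa T * τ) ^ 2 := sub_le_self _ (sq_nonneg _)

theorem mul_le_calH_of_nonneg (hj : |j| < kappa T * |τ|) (hjτ : 0 ≤ j * τ) (l : ℝ) :
    l * j ≤ calH l τ T := by
  have hκ := kappa_pos hT
  obtain ⟨hτ, hprod⟩ := ne_zero_and_abs_mul_lt hj
  calc l * j ≤ l * j + j * τ * (l * T / τ) ^ 2 := le_add_of_nonneg_right (by positivity)
    _ = j * τ / (kappa T * τ ^ 2) * (kappa T * (l * τ + l ^ 2 * T ^ 2)) := by field_simp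
    _ ≤ calH l τ T := mul_mul_le_calH hT (by positivity)
        (div_le_one_of_le₀ ((le_abs_self _).trans hprod.le) (by positivity)) l τ

theorem mul_sub_calH_le (l : ℝ) : l * j - calH l τ T ≤ calG j τ T := by
  rcases le_or_gt (kappa T * |τ|) |j| with h | h
  · exact calG_of_mul_abs_le hT h ▸ mul_sub_calH_le_sq_div hT l
  rw [calG_of_abs_lt h]
  rcases le_total 0 (j * τ) with hjτ | hjτ
  · exact (sub_nonpos.2 (mul_le_calH_of_nonneg hT h hjτ l)).trans (le_max_left _ _)
  · -- The Gallavotti–Cohen symmetry reverses the sign of the current.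
    have hdual := mul_le_calH_of_nonneg hT (j := -j) (τ := τ)
      (by rwa [abs_neg]) (by linarith) (-(τ / T ^ 2) - l)
    rw [calH_neg_div_sq_sub hT] at hdual
    refine le_trans ?_ (le_max_right _ _)
    calc l * j - calH l τ T ≤ l * j - (-(τ / T ^ 2) - l) * -j := by gcongr
      _ = -(j * τ) / T ^ 2 := by ring

theorem calG_nonneg : 0 ≤ calG j τ T := by
  have h := mul_sub_calH_le hT (j := j) (τ := τ) 0
  rw [calH_eq_kappa_mul_max hT] at h
  simpa using h

theorem div_mul_sub_calH_eq (h : kappa T * |τ| ≤ |j|) :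
    (j - kappa T * τ) / (2 * kappa T * T ^ 2) * j -
        calH ((j - kappa T * τ) / (2 * kappa T * T ^ 2)) τ T =
      (j - kappa T * τ) ^ 2 / (4 * kappa T * T ^ 2) := by
  have hκ := kappa_pos hT
  have hsq : (kappa T * τ) ^ 2 ≤ j ^ 2 := sq_le_sq.2 (by rwa [abs_mul, abs_of_pos hκ])
  have hexcess : (j - kappa T * τ) / (2 * kappa T * T ^ 2) * τ +
      ((j - kappa T * τ) / (2 * kappa T * T ^ 2)) ^ 2 * T ^ 2 =
      (j ^ 2 - (kappa T * τ) ^ 2) / (4 * kappa T ^ 2 * T ^ 2) := by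
    field_simp
    ring
  rw [calH_eq_kappa_mul_max hT, hexcess,
    max_eq_right (div_nonneg (sub_nonneg.2 hsq) (by positivity))]
  field_simp
  ring

theorem exists_mul_sub_calH_eq_calG (j τ : ℝ) : ∃ l : ℝ,
    l * j - calH l τ T = calG j τ T ∧ |l| ≤ |j| / (kappa T * T ^ 2) + |τ| / T ^ 2 := by
  have hκ := kappa_pos hT
  have hzero : calH 0 τ T = 0 := by simp [calH_eq_kappa_mul_max hT]
  rcases le_or_gt (kappa T * |τ|) |j| with h | h
  · rw [calG_of_mul_abs_le hT h]
    refine ⟨_, div_mul_sub_calH_eq hT h, le_add_of_le_of_nonneg ?_ (by positivity)⟩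
    have htriangle : |j - kappa T * τ| ≤ 2 * |j| := by
      have := abs_sub j (kappa T * τ)
      rw [abs_mul, abs_of_pos hκ] at this
      linarith
    calc |(j - kappa T * τ) / (2 * kappa T * T ^ 2)|
        = |j - kappa T * τ| / (2 * (kappa T * T ^ 2)) := by
          rw [abs_div, ← mul_assoc, abs_of_pos (show 0 < 2 * kappa T * T ^ 2 by positivity)]
      _ ≤ 2 * |j| / (2 * (kappa T * T ^ 2)) := by gcongr
      _ = |j| / (kappa T * T ^ 2) := mul_div_mul_left _ _ two_ne_zero
  rw [calG_of_abs_lt h]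
  rcases le_total 0 (j * τ) with hjτ | hjτ
  · refine ⟨0, ?_, by rw [abs_zero]; positivity⟩
    rw [max_eq_left (div_nonpos_of_nonpos_of_nonneg (neg_nonpos.2 hjτ) (sq_nonneg T)), hzero,
      zero_mul, sub_zero]
  · refine ⟨-(τ / T ^ 2) - 0, ?_, ?_⟩
    · rw [max_eq_right (div_nonneg (neg_nonneg.2 hjτ) (sq_nonneg T)), calH_neg_div_sq_sub hT, hzero]
      ring
    · rw [sub_zero, abs_neg, abs_div, abs_of_pos (pow_pos hT 2)]
      exact le_add_of_nonneg_left (by positivity)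

end LegendreTransform

/-! ### Uniform convergence -/

theorem iSup_mul_sub_mem_Icc {F : ℝ → EReal} {H : ℝ → ℝ} {j G R B δ : ℝ} (hδ : 0 ≤ δ)
    (hG : 0 ≤ G) (hj : |j| ≤ B) (hle : ∀ l, l * j - H l ≤ G)
    (hmax : ∃ l, |l| ≤ R ∧ l * j - H l = G)
    (hF : ∀ l, |l| ≤ R → F l ∈ Set.Icc ((H l - δ : ℝ) : EReal) ((H l + δ : ℝ) : EReal))
    (hcoercive : ∀ l, R ≤ |l| → ((|l| * B : ℝ) : EReal) ≤ F l) :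
    (⨆ l : ℝ, ((l * j : ℝ) : EReal) - F l) ∈
      Set.Icc ((G - δ : ℝ) : EReal) ((G + δ : ℝ) : EReal) := by
  constructor
  · obtain ⟨l, hl, hlG⟩ := hmax
    calc ((G - δ : ℝ) : EReal) = ((l * j : ℝ) : EReal) - ((H l + δ : ℝ) : EReal) := by
          rw [← EReal.coe_sub, ← hlG, sub_sub]
      _ ≤ ((l * j : ℝ) : EReal) - F l := EReal.sub_le_sub le_rfl (hF l hl).2
      _ ≤ ⨆ l : ℝ, ((l * j : ℝ) : EReal) - F l :=
          le_iSup (fun l : ℝ => ((l * j : ℝ) : EReal) - F l) l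
  · refine iSup_le fun l => ?_
    rcases le_total |l| R with hl | hl
    · refine (EReal.sub_le_sub le_rfl (hF l hl).1).trans ?_
      rw [← EReal.coe_sub, EReal.coe_le_coe_iff]
      linarith [hle l]
    · refine (EReal.sub_le_sub le_rfl (hcoercive l hl)).trans ?_
      have hlj : l * j ≤ |l| * B :=
        (le_abs_self _).trans (abs_mul l j ▸ mul_le_mul_of_nonneg_left hj (abs_nonneg l))
      rw [← EReal.coe_sub, EReal.coe_le_coe_iff]
      linarith

theorem coe_mul_iSup {ι : Sort*} {c : ℝ} (hc : 0 < c) (f : ι → EReal) :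
    (c : EReal) * ⨆ i, f i = ⨆ i, (c : EReal) * f i := by
  have hcont : ContinuousAt (fun x : EReal => (c : EReal) * x) (⨆ i, f i) := by
    refine ContinuousAt.comp (f := fun x : EReal => ((c : EReal), x))
      (EReal.continuousAt_mul ?_ ?_ ?_ ?_) (by fun_prop) <;> simp [hc.ne']
  exact Monotone.map_iSup_of_continuousAt hcont
    (fun _ _ h => mul_le_mul_of_nonneg_left h (EReal.coe_nonneg.2 hc.le))
    (EReal.coe_mul_bot_of_pos hc)

theorem one_div_sq_mul_calI (q₀ : ℝ) {p₀ : ℝ} (hp₀ : p₀ ≠ 0) {ε τ T : ℝ} (hε : 0 < ε)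
    (hετ : |ε * τ| < T) (j : ℝ) : ((1 / ε ^ 2 : ℝ) : EReal) * calI q₀ p₀ (ε * j) (ε * τ) T =
      ⨆ l : ℝ, ((l * j : ℝ) : EReal) - rescaledGrowthRate ε l τ T := by
  have hc : 0 < 1 / ε ^ 2 := by positivity
  rw [calI, ← (Equiv.mulLeft₀ ε hε.ne').iSup_comp, coe_mul_iSup hc]
  congr 1 with l
  rw [Equiv.mulLeft₀_apply, EReal.mul_sub_of_nonneg_of_ne_top (EReal.coe_nonneg.2 hc.le)
    (EReal.coe_ne_top _), one_div_sq_mul_calF q₀ hp₀ hετ, ← one_div_sq_mul_coe hε (l * j)]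
  ring_nf

theorem exists_abs_le_and_pos_le {K : Set (ℝ × ℝ × ℝ)} (hK : IsCompact K)
    (hpos : ∀ x ∈ K, 0 < x.2.2) :
    ∃ B T₀ : ℝ, 0 < T₀ ∧ ∀ x ∈ K, |x.1| ≤ B ∧ |x.2.1| ≤ B ∧ T₀ ≤ x.2.2 := by
  obtain ⟨B, hB⟩ := hK.isBounded.exists_norm_le
  obtain ⟨T₀, hT₀, hT⟩ := hK.exists_forall_le' (by fun_prop) hpos
  exact ⟨B, T₀, hT₀, fun x hx => ⟨(norm_fst_le x).trans (hB x hx),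
    ((norm_fst_le x.2).trans (norm_snd_le x)).trans (hB x hx), hT x hx⟩⟩

theorem eventually_forall_abs_mul_lt {K : Set (ℝ × ℝ × ℝ)} (hK : IsCompact K)
    (hpos : ∀ x ∈ K, 0 < x.2.2) : ∀ᶠ ε : ℝ in 𝓝[>] 0, ∀ x ∈ K, |ε * x.2.1| < x.2.2 :=
  nhdsWithin_le_nhds <| hK.eventually_forall_of_forall_eventually fun ⟨l, τ, _⟩ hx =>
    eventually_abs_mul_lt (hpos _ hx) l τ

section Convergence

variable (q₀ : ℝ) {p₀ : ℝ} (hp₀ : p₀ ≠ 0) {K : Set (ℝ × ℝ × ℝ)} (hK : IsCompact K)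
  (hpos : ∀ x ∈ K, 0 < x.2.2) {δ : ℝ} (hδ : 0 < δ)

include hK hpos hδ

theorem eventually_forall_iSup_mem_Icc :
    ∀ᶠ ε : ℝ in 𝓝[>] 0, ∀ x ∈ K,
      (⨆ l : ℝ, ((l * x.1 : ℝ) : EReal) - rescaledGrowthRate ε l x.2.1 x.2.2) ∈ Set.Icc
        ((calG x.1 x.2.1 x.2.2 - δ : ℝ) : EReal) ((calG x.1 x.2.1 x.2.2 + δ : ℝ) : EReal) := by
  obtain ⟨B, T₀, hT₀, hbound⟩ := exists_abs_le_and_pos_le hK hpos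
  obtain ⟨R, hR⟩ := exists_forall_abs_mul_le_rescaledGrowthRate hT₀ B
  set R' := max R (B / (kappa T₀ * T₀ ^ 2) + B / T₀ ^ 2)
  have hκ₀ : 0 < kappa T₀ := kappa_pos hT₀
  have hK' : IsCompact (Set.Icc (-R') R' ×ˢ (Prod.snd '' K)) :=
    isCompact_Icc.prod (hK.image continuous_snd)
  have hpos' : ∀ x ∈ Set.Icc (-R') R' ×ˢ (Prod.snd '' K), 0 < x.2.2 := by
    rintro ⟨l, _⟩ ⟨-, x, hx, rfl⟩
    exact hpos x hx
  filter_upwards [eventually_forall_rescaledGrowthRate_mem_Ioo hK' hpos' hδ,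
    eventually_forall_abs_mul_lt hK hpos, self_mem_nhdsWithin] with ε hF hετ hε x hx
  obtain ⟨hj, hτ, hT⟩ := hbound x hx
  have hB : 0 ≤ B := (abs_nonneg _).trans hj
  have hκ : kappa T₀ ≤ kappa x.2.2 := monotone_kappa hT
  obtain ⟨l, hlG, hl⟩ := exists_mul_sub_calH_eq_calG (hpos x hx) x.1 x.2.1
  have hlR : |l| ≤ R' := calc
    |l| ≤ |x.1| / (kappa x.2.2 * x.2.2 ^ 2) + |x.2.1| / x.2.2 ^ 2 := hl
    _ ≤ B / (kappa T₀ * T₀ ^ 2) + B / T₀ ^ 2 := by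
      gcongr
      exact hκ₀.le.trans hκ
    _ ≤ R' := le_max_right _ _
  exact iSup_mul_sub_mem_Icc hδ.le (calG_nonneg (hpos x hx)) hj
    (mul_sub_calH_le (hpos x hx)) ⟨l, hlR, hlG⟩
    (fun l hl => Set.Ioo_subset_Icc_self (hF (l, x.2) ⟨abs_le.1 hl, x, hx, rfl⟩))
    fun l hl => hR ε l _ _ hε (hετ x hx) hτ hT ((le_max_left _ _).trans hl)

include hp₀

theorem eventually_forall_calF_mem_Ioo : ∀ᶠ ε : ℝ in 𝓝[>] 0, ∀ x ∈ K,
    ((1 / ε ^ 2 : ℝ) : EReal) * calF q₀ p₀ (ε * x.1) (ε * x.2.1) x.2.2 ∈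
      Set.Ioo ((calH x.1 x.2.1 x.2.2 - δ : ℝ) : EReal)
        ((calH x.1 x.2.1 x.2.2 + δ : ℝ) : EReal) := by
  filter_upwards [eventually_forall_rescaledGrowthRate_mem_Ioo hK hpos hδ,
    eventually_forall_abs_mul_lt hK hpos] with ε hmem hετ x hx
  exact one_div_sq_mul_calF q₀ hp₀ (hετ x hx) ▸ hmem x hx

theorem eventually_forall_calI_mem_Ioo : ∀ᶠ ε : ℝ in 𝓝[>] 0, ∀ x ∈ K,
    ((1 / ε ^ 2 : ℝ) : EReal) * calI q₀ p₀ (ε * x.1) (ε * x.2.1) x.2.2 ∈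
      Set.Ioo ((calG x.1 x.2.1 x.2.2 - δ : ℝ) : EReal)
        ((calG x.1 x.2.1 x.2.2 + δ : ℝ) : EReal) := by
  filter_upwards [eventually_forall_iSup_mem_Icc hK hpos (half_pos hδ),
    eventually_forall_abs_mul_lt hK hpos, self_mem_nhdsWithin] with ε hmem hετ hε x hx
  rw [one_div_sq_mul_calI q₀ hp₀ hε (hετ x hx)]
  exact ⟨(EReal.coe_lt_coe_iff.2 (by linarith)).trans_le (hmem x hx).1,
    (hmem x hx).2.trans_lt (EReal.coe_lt_coe_iff.2 (by linarith))⟩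

end Convergence

theorem tendsto_coe_of_forall_eventually_mem_Ioo {α : Type*} {u : α → EReal} {a : ℝ} {F : Filter α}
    (h : ∀ δ : ℝ, 0 < δ → ∀ᶠ x in F, u x ∈ Set.Ioo ((a - δ : ℝ) : EReal) ((a + δ : ℝ) : EReal)) :
    Tendsto u F (𝓝 (a : EReal)) := by
  refine tendsto_order.2 ⟨fun b hb => ?_, fun b hb => ?_⟩
  · obtain ⟨y, hy, hya⟩ := EReal.lt_iff_exists_real_btwn.1 hb
    filter_upwards [h (a - y) (sub_pos.2 (EReal.coe_lt_coe_iff.1 hya))] with x hx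
    rw [sub_sub_cancel] at hx
    exact hy.trans hx.1
  · obtain ⟨y, hay, hy⟩ := EReal.lt_iff_exists_real_btwn.1 hb
    filter_upwards [h (y - a) (sub_pos.2 (EReal.coe_lt_coe_iff.1 hay))] with x hx
    rw [add_sub_cancel] at hx
    exact hx.2.trans hy

section Limits

variable (q₀ : ℝ) {p₀ : ℝ} (hp₀ : p₀ ≠ 0) {T : ℝ} (hT : 0 < T)

include hp₀ hT

theorem tendsto_one_div_sq_mul_calF (l τ : ℝ) :
    Tendsto (fun ε : ℝ => ((1 / ε ^ 2 : ℝ) : EReal) * calF q₀ p₀ (ε * l) (ε * τ) T)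
      (𝓝[>] 0) (𝓝 ((calH l τ T : ℝ) : EReal)) :=
  tendsto_coe_of_forall_eventually_mem_Ioo fun _ hδ =>
    (eventually_forall_calF_mem_Ioo q₀ hp₀ (K := {(l, τ, T)}) isCompact_singleton
      (by rintro x rfl; exact hT) hδ).mono fun _ h => h _ rfl

theorem tendsto_one_div_sq_mul_calI (j τ : ℝ) :
    Tendsto (fun ε : ℝ => ((1 / ε ^ 2 : ℝ) : EReal) * calI q₀ p₀ (ε * j) (ε * τ) T)
      (𝓝[>] 0) (𝓝 ((calG j τ T : ℝ) : EReal)) :=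
  tendsto_coe_of_forall_eventually_mem_Ioo fun _ hδ =>
    (eventually_forall_calI_mem_Ioo q₀ hp₀ (K := {(j, τ, T)}) isCompact_singleton
      (by rintro x rfl; exact hT) hδ).mono fun _ h => h _ rfl

end Limits

end ConfinedTracer

end

theorem mainTheorem2 (q₀ p₀ : ℝ) (hq₀ : q₀ ∈ Set.Icc (0 : ℝ) 1) (hp₀ : p₀ ≠ 0) :
    -- the limit that defines the cumulant generating function exists
    (∀ l βL βR : ℝ, 0 < βL → 0 < βR →
      Tendsto (fun t : ℝ => ConfinedTracer.scaledCumulant q₀ p₀ βL βR l t) atTop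
        (𝓝 (ConfinedTracer.cumulantGF q₀ p₀ l βL βR))) ∧
    -- the limits for `τ ≠ 0`
    (∀ τ T : ℝ, 0 < T → τ ≠ 0 →
      (∀ l : ℝ, Tendsto
        (fun ε : ℝ => ((1 / ε ^ 2 : ℝ) : EReal) * ConfinedTracer.calF q₀ p₀ (ε * l) (ε * τ) T)
        (𝓝[>] 0) (𝓝 ((ConfinedTracer.calH l τ T : ℝ) : EReal))) ∧
      (∀ j : ℝ, Tendsto
        (fun ε : ℝ => ((1 / ε ^ 2 : ℝ) : EReal) * ConfinedTracer.calI q₀ p₀ (ε * j) (ε * τ) T)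
        (𝓝[>] 0) (𝓝 ((ConfinedTracer.calG j τ T : ℝ) : EReal)))) ∧
    -- the limits for `τ = 0`
    (∀ T : ℝ, 0 < T →
      (∀ l : ℝ, Tendsto
        (fun ε : ℝ => ((1 / ε ^ 2 : ℝ) : EReal) * ConfinedTracer.calF q₀ p₀ (ε * l) (ε * 0) T)
        (𝓝[>] 0) (𝓝 ((ConfinedTracer.kappa T * l ^ 2 * T ^ 2 : ℝ) : EReal))) ∧
      (∀ j : ℝ, Tendsto
        (fun ε : ℝ => ((1 / ε ^ 2 : ℝ) : EReal) * ConfinedTracer.calI q₀ p₀ (ε * j) (ε * 0) T)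
        (𝓝[>] 0) (𝓝 ((j ^ 2 / (4 * ConfinedTracer.kappa T * T ^ 2) : ℝ) : EReal)))) ∧
    -- uniformity on compact sets of parameters `(l, τ, T)`, respectively `(j, τ, T)`
    (∀ K : Set (ℝ × ℝ × ℝ), IsCompact K → (∀ x ∈ K, 0 < x.2.2) → ∀ δ : ℝ, 0 < δ →
      (∀ᶠ ε : ℝ in 𝓝[>] 0, ∀ l τ T : ℝ, (l, τ, T) ∈ K →
        ((ConfinedTracer.calH l τ T - δ : ℝ) : EReal) <
            ((1 / ε ^ 2 : ℝ) : EReal) * ConfinedTracer.calF q₀ p₀ (ε * l) (ε * τ) T ∧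
          ((1 / ε ^ 2 : ℝ) : EReal) * ConfinedTracer.calF q₀ p₀ (ε * l) (ε * τ) T <
            ((ConfinedTracer.calH l τ T + δ : ℝ) : EReal)) ∧
      (∀ᶠ ε : ℝ in 𝓝[>] 0, ∀ j τ T : ℝ, (j, τ, T) ∈ K →
        ((ConfinedTracer.calG j τ T - δ : ℝ) : EReal) <
            ((1 / ε ^ 2 : ℝ) : EReal) * ConfinedTracer.calI q₀ p₀ (ε * j) (ε * τ) T ∧
          ((1 / ε ^ 2 : ℝ) : EReal) * ConfinedTracer.calI q₀ p₀ (ε * j) (ε * τ) T <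
            ((ConfinedTracer.calG j τ T + δ : ℝ) : EReal))) := by
  refine ⟨fun l βL βR hL hR => ?_, fun τ T hT _ =>
      ⟨fun l => ConfinedTracer.tendsto_one_div_sq_mul_calF q₀ hp₀ hT l τ,
        fun j => ConfinedTracer.tendsto_one_div_sq_mul_calI q₀ hp₀ hT j τ⟩,
    fun T hT => ⟨fun l => ?_, fun j => ?_⟩, fun K hK hpos δ hδ => ⟨?_, ?_⟩⟩
  · rw [ConfinedTracer.cumulantGF_eq_growthRate hL hR q₀ hp₀]
    exact ConfinedTracer.tendsto_scaledCumulant hL hR q₀ hp₀ l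
  · simpa [ConfinedTracer.calH] using
      ConfinedTracer.tendsto_one_div_sq_mul_calF q₀ hp₀ hT l 0
  · simpa [ConfinedTracer.calG] using
      ConfinedTracer.tendsto_one_div_sq_mul_calI q₀ hp₀ hT j 0
  · filter_upwards [ConfinedTracer.eventually_forall_calF_mem_Ioo q₀ hp₀ hK hpos hδ]
      with ε hε l τ T hx using hε _ hx
  · filter_upwards [ConfinedTracer.eventually_forall_calI_mem_Ioo q₀ hp₀ hK hpos hδ]
      with ε hε j τ T hx using hε _ hx
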